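/- \textbf{Problem.} Let $F:\mathbb{R}^p\to\mathbb{R}^p$ be single-valued and $T:\mathbb{R}^p\rightrightarrows\mathbb{R}^p$ be set-valued, $\Phi:=F+T$, and consider the inclusion $0\in\Phi x$. Let $P$ be a probability distribution and $\mathbf{F}(\cdot,\xi)$, $\xi\sim P$, a (jointly measurable) stochastic oracle. Let $L>0$, $\rho\ge 0$, $\sigma\ge 0$. Assume: (a) $\mathrm{zer}\,\Phi:=\{x : 0\in\Phi x\}\neq\emptyset$; (b) for all $x$, $\mathbb{E}_\xi[\mathbf{F}(x,\xi)]=Fx$ and $\mathbb{E}_\xi\|\mathbf{F}(x,\xi)-Fx\|^2\le\sigma^2$; (c) for all $x,y$, $\langle Fx-Fy,x-y\rangle\ge\frac1L\mathbb{E}_\xi\|\mathbf{F}(x,\xi)-\mathbf{F}(y,\xi)\|^2$; (d) $T$ is maximally $\rho$-co-hypomonotone, i.e. $\langle u-v,x-y\rangle\ge-\rho\|u-v\|^2$ for all $u\in Tx$, $v\in Ty$, and the graph of $T$ is not properly contained in the graph of another operator with this property. For $\lambda>0$ let $J_{\lambda T}x$ be the resolvent, i.e. the point $w$ with $x\in w+\lambda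 Tw$, and let $G_\lambda x:=\frac1\lambda\big(x-J_{\lambda T}(x-\lambda Fx)\big)$. \textbf{Parameters.} Let $\hat L>L$ with $\hat L\rho<1$; let $\lambda>0$ with $2\rho\le\lambda<\frac{2(1+\sqrt{1-\hat L\rho})}{\hat L}$; $0<\mu<\frac23$; $\nu:=\frac\mu2$; $r\ge5+\frac1\mu$; $\bar\beta:=\frac{\lambda(4-\hat L\lambda)-4\rho}{4(1-\rho\hat L)}$; $0<\beta\le\frac{(2-\mu)\bar\beta}{2+\mu}$; $t_k:=\mu(k+r)$; $\eta_k:=\frac{2\beta(t_k-1)}{t_k-\nu}$. \textbf{Method (VFOSA$_+$ with Hybrid-SGD).} Given $\epsilon\in(0,\frac12]$ and constants $c_n,c_b,\hat c_b>0$, put $$\tau_k:=1-\sqrt{\frac{(1-\epsilon)\,t_{k-1}(t_{k-1}-1)}{t_k(t_k-1)}},\qquad n_0:=\Big\lfloor\frac{c_n}{\epsilon}\Big\rfloor,\quad b:=\Big\lfloor\frac{c_b}{\epsilon}\Big\rfloor,\quad \hat b:=\Big\lfloor\frac{\hat c_b}{\epsilon^2}\Big\rfloor .$$ Start from a deterministic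 $x^0=z^0\in\mathrm{dom}\,\Phi$. For $k\ge0$ set $$\widetilde G^k:=\tfrac1\lambda\big(x^k-J_{\lambda T}(x^k-\lambda\widetilde F^k)\big),\quad y^k:=\tfrac{t_k-1}{t_k}x^k+\tfrac1{t_k}z^k,\quad x^{k+1}:=y^k-\eta_k\widetilde G^k,\quad z^{k+1}:=z^k+\nu(x^{k+1}-y^k),$$ where $\widetilde F^0$ is computed from the oracle answers at $x^0$ for an i.i.d. sample of size $n_0$ and satisfies $\mathbb{E}\|\widetilde F^0-Fx^0\|^2\le\sigma^2/n_0$, and for $k\ge1$ $$\widetilde F^k:=(1-\tau_k)\Big[\widetilde F^{k-1}+\tfrac1b\sum_{\xi\in\mathcal S_k}\big(\mathbf F(x^k,\xi)-\mathbf F(x^{k-1},\xi)\big)\Big]+\tau_k\bar Fx^k .$$ Here $\mathcal S_k$ and $\hat{\mathcal S}_k$ are i.i.d. samples from $P$ of sizes $b$ and $\hat b$, each independent of everything drawn before iteration $k$ (they may depend on each other), and $\bar Fx^k$ is computed from the oracle answers at $x^k$ for the sample $\hat{\mathcal S}_k$ by a rule which at every fixed $x$ gives an unbiased estimator of $Fx$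 with variance at most $\sigma^2/\hat b$ (e.g. the mini-batch average). \textbf{Claim.} For every $R$ there are constants $c_n,c_b,\hat c_b,C>0$ that depend only on $L,\hat L,\rho,\sigma,\lambda,\mu,r,\beta,R$ (in particular not on $\epsilon$) such that for every $\epsilon\in(0,\frac12]$ the batch sizes $n_0,b,\hat b$ are positive, $\tau_k\in[0,1]$ for all $k\ge 0$, and there is an iteration number $K$ such that, for every problem as above, every $x^0\in\mathrm{dom}\,\Phi$ for which some $x^\star\in\mathrm{zer}\,\Phi$ satisfies $\|x^0-x^\star\|\le R$, and every run of the method, $$\mathbb{E}\big[\|G_\lambda x^K\|^2\big]\le\epsilon^2,$$ and the expected total number of oracle calls $\mathbf F(\cdot,\xi)$ and evaluations of $J_{\lambda T}$ made to obtain $x^K$ is at most $C\epsilon^{-3}$ (no logarithmic factor). -/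

import Mathlib

open MeasureTheory ProbabilityTheory

namespace VFOSA

/-- The space `ℝ^p` with its Euclidean norm and standard inner product. -/
abbrev E (p : ℕ) := EuclideanSpace ℝ (Fin p)

/-! ### Set-valued operators, resolvent, residual -/

/-- `T` is `ρ`-co-hypomonotone: `⟨u - v, x - y⟩ ≥ -ρ ‖u - v‖²` on the graph of `T`. -/
def Cohypomonotone {p : ℕ} (ρ : ℝ) (T : E p → Set (E p)) : Prop :=
  ∀ x y u v, u ∈ T x → v ∈ T y → inner ℝ (u - v) (x - y) ≥ -ρ * ‖u - v‖ ^ 2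

/-- `T` is maximally `ρ`-co-hypomonotone: its graph is not properly contained in the graph of
another `ρ`-co-hypomonotone operator. -/
def MaximallyCohypomonotone {p : ℕ} (ρ : ℝ) (T : E p → Set (E p)) : Prop :=
  Cohypomonotone ρ T ∧
    ∀ T' : E p → Set (E p), Cohypomonotone ρ T' → (∀ x, T x ⊆ T' x) → T' = T

/-- `dom T`. -/
def dom {p : ℕ} (T : E p → Set (E p)) : Set (E p) := {x | (T x).Nonempty}

/-- The operator `Φ = F + T`. -/
def sumOp {p : ℕ} (F : E p → E p) (T : E p → Set (E p)) : E p → Set (E p) :=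
  fun x => (fun v => F x + v) '' T x

/-- `zer Φ = {x | 0 ∈ Φ x}`. -/
def zer {p : ℕ} (Φ : E p → Set (E p)) : Set (E p) := {x | (0 : E p) ∈ Φ x}

/-- The resolvent `J_{λT} x = {w | x ∈ w + λ T w}` as a set. -/
def resolventSet {p : ℕ} (lam : ℝ) (T : E p → Set (E p)) (x : E p) : Set (E p) :=
  {w | ∃ v ∈ T w, x = w + lam • v}

open Classical in
/-- The resolvent `J_{λT}` as a single-valued map.  (If `T` is maximally `ρ`-co-hypomonotone and
`λ > ρ ≥ 0`, then `resolventSet lam T x` has exactly one element; otherwise an element is chosen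
when there is one.) -/
noncomputable def resolvent {p : ℕ} (lam : ℝ) (T : E p → Set (E p)) (x : E p) : E p :=
  if h : (resolventSet lam T x).Nonempty then h.some else 0

/-- The forward-backward splitting residual `G_λ x = (x - J_{λT}(x - λ F x)) / λ`. -/
noncomputable def residual {p : ℕ} (lam : ℝ) (F : E p → E p) (T : E p → Set (E p)) (x : E p) :
    E p :=
  (1 / lam) • (x - resolvent lam T (x - lam • F x))

/-! ### The problem class -/

/-- The expectation setting: `bF` is an unbiased stochastic oracle of `F` for `ξ ∼ P`, of variance
at most `σ²`; `F` is `1/L`-co-coercive in expectation; `T` is maximally `ρ`-co-hypomonotone. -/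
structure ExpectationSetting {p : ℕ} {Ξ : Type*} [MeasurableSpace Ξ] (P : Measure Ξ)
    (bF : E p → Ξ → E p) (F : E p → E p) (T : E p → Set (E p)) (L ρ σ : ℝ) : Prop where
  measurable_oracle : Measurable (Function.uncurry bF)
  integrable_oracle : ∀ x, Integrable (bF x) P
  unbiased : ∀ x, ∫ ξ, bF x ξ ∂P = F x
  integrable_variance : ∀ x, Integrable (fun ξ => ‖bF x ξ - F x‖ ^ 2) P
  variance_le : ∀ x, ∫ ξ, ‖bF x ξ - F x‖ ^ 2 ∂P ≤ σ ^ 2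
  cocoercive : ∀ x y,
    inner ℝ (F x - F y) (x - y) ≥ (1 / L) * ∫ ξ, ‖bF x ξ - bF y ξ‖ ^ 2 ∂P
  cohypomonotone : MaximallyCohypomonotone ρ T

/-! ### Sampling and batch estimators -/

/-- The samples used by a run on `(Ω, Pr)`.  The initial sample `S₀` of size `n₀`, and for every
`k ≥ 1` the samples `S_k` of size `b` and `Ŝ_k` of size `b̂`, are each i.i.d. with law `P`.
The σ-algebra `ℱ k` holds the randomness of the iterations before `k`; `S_k` is independent of it,
and so is `Ŝ_k`.  The joint law of `(S_k, Ŝ_k)` is arbitrary, so that the two samples may be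
independent, dependent, or (if `b = b̂`) identical. -/
structure IsSampling {Ξ Ω : Type*} [MeasurableSpace Ξ] {mΩ : MeasurableSpace Ω} (P : Measure Ξ)
    (Pr : Measure Ω) (ℱ : Filtration ℕ mΩ) {n0 b bh : ℕ}
    (S0 : Ω → Fin n0 → Ξ) (S : ℕ → Ω → Fin b → Ξ) (Sh : ℕ → Ω → Fin bh → Ξ) : Prop where
  adapted_init : Measurable[ℱ 1] S0
  adapted : ∀ k, 1 ≤ k → Measurable[ℱ (k + 1)] (S k)
  adapted_hat : ∀ k, 1 ≤ k → Measurable[ℱ (k + 1)] (Sh k)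
  law_init : Pr.map S0 = Measure.pi fun _ => P
  law : ∀ k, 1 ≤ k → Pr.map (S k) = Measure.pi fun _ => P
  law_hat : ∀ k, 1 ≤ k → Pr.map (Sh k) = Measure.pi fun _ => P
  indep : ∀ k, 1 ≤ k → Indep (MeasurableSpace.comap (S k) inferInstance) (ℱ k) Pr
  indep_hat : ∀ k, 1 ≤ k → Indep (MeasurableSpace.comap (Sh k) inferInstance) (ℱ k) Pr

/-- `est` forms, from the `m` oracle answers at `x` for an i.i.d. sample of size `m`, an unbiased
estimator of `F x` whose variance is at most `σ² / m`.  (The mini-batch average is one.) -/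
structure IsBatchEstimator {p : ℕ} {Ξ : Type*} [MeasurableSpace Ξ] (P : Measure Ξ)
    (bF : E p → Ξ → E p) (F : E p → E p) (σ : ℝ) (m : ℕ)
    (est : E p → (Fin m → E p) → E p) : Prop where
  measurable : Measurable (Function.uncurry est)
  integrable : ∀ x, Integrable (fun s : Fin m → Ξ => est x fun i => bF x (s i))
    (Measure.pi fun _ => P)
  unbiased : ∀ x, ∫ s : Fin m → Ξ, est x (fun i => bF x (s i)) ∂(Measure.pi fun _ => P) = F x
  integrable_variance : ∀ x, Integrable
    (fun s : Fin m → Ξ => ‖est x (fun i => bF x (s i)) - F x‖ ^ 2) (Measure.pi fun _ => P)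
  variance_le : ∀ x, ∫ s : Fin m → Ξ, ‖est x (fun i => bF x (s i)) - F x‖ ^ 2
    ∂(Measure.pi fun _ => P) ≤ σ ^ 2 / m

/-- `est0` forms, from the `m` oracle answers at the initial point `x0`, an estimator of `F x0`
(possibly biased) whose mean-square error is at most `σ² / m`. -/
structure IsInitialEstimator {p : ℕ} {Ξ : Type*} [MeasurableSpace Ξ] (P : Measure Ξ)
    (bF : E p → Ξ → E p) (F : E p → E p) (σ : ℝ) (m : ℕ) (x0 : E p)
    (est0 : (Fin m → E p) → E p) : Prop where
  measurable : Measurable est0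
  integrable_error : Integrable
    (fun s : Fin m → Ξ => ‖est0 (fun i => bF x0 (s i)) - F x0‖ ^ 2) (Measure.pi fun _ => P)
  error_le : ∫ s : Fin m → Ξ, ‖est0 (fun i => bF x0 (s i)) - F x0‖ ^ 2
    ∂(Measure.pi fun _ => P) ≤ σ ^ 2 / m

/-! ### The algorithm -/

/-- Parameters of the method: `λ, μ, r, β`, the parameter `θ` of the weights, and the batch sizes
`n₀`, `b`, `b̂`. -/
structure Config where
  lam : ℝ
  mu : ℝ
  r : ℝ
  beta : ℝ
  theta : ℝ
  n0 : ℕ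
  b : ℕ
  bh : ℕ

/-- `t_k = μ (k + r)`; the index is real so that `t_{k-1}` makes sense for `k = 0`. -/
def Config.t (c : Config) (k : ℝ) : ℝ := c.mu * (k + c.r)

/-- `ν = μ / 2`. -/
noncomputable def Config.nu (c : Config) : ℝ := c.mu / 2

/-- `η_k = 2 β (t_k - 1) / (t_k - ν)`. -/
noncomputable def Config.eta (c : Config) (k : ℝ) : ℝ :=
  2 * c.beta * (c.t k - 1) / (c.t k - c.nu)

/-- `τ_k = 1 - √((1 - θ) t_{k-1} (t_{k-1} - 1) / (t_k (t_k - 1)))`. -/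
noncomputable def Config.tau (c : Config) (k : ℝ) : ℝ :=
  1 - Real.sqrt ((1 - c.theta) * c.t (k - 1) * (c.t (k - 1) - 1) / (c.t k * (c.t k - 1)))

/-- The state at the start of iteration `k`: `x^k`, `z^k`, the previous iterate `x^{k-1}`, the
previous estimate `F̃^{k-1}`, and the numbers of oracle calls `bF(·, ξ)` and of evaluations of
`J_{λT}` made so far. -/
structure State (p : ℕ) where
  x : E p
  z : E p
  xPrev : E p
  fPrev : E p
  oracleCalls : ℕ
  resolventCalls : ℕ

/-- The mini-batch average `(1/b) ∑ bF(x, ξ_i)`. -/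
noncomputable def miniBatch {p : ℕ} {Ξ : Type*} (bF : E p → Ξ → E p) {b : ℕ} (x : E p)
    (s : Fin b → Ξ) : E p :=
  (b : ℝ)⁻¹ • ∑ i, bF x (s i)

/-- The Hybrid-SGD estimate `F̃^k`:  `F̃^0` comes from the initial batch, and for `k ≥ 1`
`F̃^k = (1 - τ_k) (F̃^{k-1} + bF(x^k, S_k) - bF(x^{k-1}, S_k)) + τ_k F̄x^k`. -/
noncomputable def hybridEstimate {p : ℕ} {Ξ : Type*} (c : Config) (bF : E p → Ξ → E p)
    (est0 : (Fin c.n0 → E p) → E p) (est : ℕ → E p → (Fin c.bh → E p) → E p)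
    (s0 : Fin c.n0 → Ξ) (s : ℕ → Fin c.b → Ξ) (sh : ℕ → Fin c.bh → Ξ) (k : ℕ) (q : State p) :
    E p :=
  if k = 0 then est0 fun i => bF q.x (s0 i)
  else (1 - c.tau k) • (q.fPrev + miniBatch bF q.x (s k) - miniBatch bF q.xPrev (s k))
    + c.tau k • est k q.x fun j => bF q.x (sh k j)

/-- Iteration `k` of the method.  The estimate costs `n₀` oracle calls for `k = 0`, and
`2 b + b̂` for `k ≥ 1`; one resolvent is evaluated. -/
noncomputable def step {p : ℕ} {Ξ : Type*} (c : Config) (bF : E p → Ξ → E p)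
    (T : E p → Set (E p))
    (est0 : (Fin c.n0 → E p) → E p) (est : ℕ → E p → (Fin c.bh → E p) → E p)
    (s0 : Fin c.n0 → Ξ) (s : ℕ → Fin c.b → Ξ) (sh : ℕ → Fin c.bh → Ξ) (k : ℕ) (q : State p) :
    State p :=
  let f := hybridEstimate c bF est0 est s0 s sh k q
  let g := (1 / c.lam) • (q.x - resolvent c.lam T (q.x - c.lam • f))
  let y := ((c.t k - 1) / c.t k) • q.x + (1 / c.t k) • q.z
  let xNext := y - c.eta k • g
  { x := xNext
    z := q.z + c.nu • (xNext - y)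
    xPrev := q.x
    fPrev := f
    oracleCalls := q.oracleCalls + if k = 0 then c.n0 else 2 * c.b + c.bh
    resolventCalls := q.resolventCalls + 1 }

/-- The run of the method from `x^0 = z^0 = x0`; `run … k` is the state at the start of
iteration `k`.  (The initial values of `xPrev` and `fPrev` are never used.) -/
noncomputable def run {p : ℕ} {Ξ : Type*} (c : Config) (bF : E p → Ξ → E p)
    (T : E p → Set (E p)) (x0 : E p)
    (est0 : (Fin c.n0 → E p) → E p) (est : ℕ → E p → (Fin c.bh → E p) → E p)
    (s0 : Fin c.n0 → Ξ) (s : ℕ → Fin c.b → Ξ) (sh : ℕ → Fin c.bh → Ξ) : ℕ → State p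
  | 0 => ⟨x0, x0, x0, 0, 0, 0⟩
  | k + 1 => step c bF T est0 est s0 s sh k (run c bF T x0 est0 est s0 s sh k)

/-- `β̄ = (λ (4 - L̂ λ) - 4 ρ) / (4 (1 - ρ L̂))`. -/
noncomputable def betaBar (lam Lhat ρ : ℝ) : ℝ :=
  (lam * (4 - Lhat * lam) - 4 * ρ) / (4 * (1 - ρ * Lhat))

/-- The configuration for the tolerance `ε`: `θ = ε`, `n₀ = ⌊c_n/ε⌋`, `b = ⌊c_b/ε⌋`,
`b̂ = ⌊ĉ_b/ε²⌋`. -/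
noncomputable def config (lam mu r beta cn cb cbh ε : ℝ) : Config where
  lam := lam
  mu := mu
  r := r
  beta := beta
  theta := ε
  n0 := ⌊cn / ε⌋₊
  b := ⌊cb / ε⌋₊
  bh := ⌊cbh / ε ^ 2⌋₊

end VFOSA

/-! The residual `G_λ` is co-coercive with modulus `β̄` and vanishes on `zer Φ`; the method is an
accelerated scheme for `G_λ x = 0` driven by an inexact value of `F`. Co-coercivity
(`residual_cocoercive`) comes from completing a square, and because `L̂ > L` it leaves a surplus `Λ
𝔼‖bF(x,ξ) - bF(y,ξ)‖²` with `Λ = 1/L - 1/L̂ > 0`. The resolvent is defined everywhere by a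
Minty-type argument based on Kirszbraun's extension, and for `λ ≥ 2ρ` it is nonexpansive, so the
error of the computed residual is at most the error of `F̃^k`.

The Lyapunov function is `V_k = t_{k-1}(t_{k-1}-1)β‖G‖² + t_{k-1}⟨G, x-z⟩ + w_k‖z-x*‖²`, with `G`,
`x`, `z` taken at step `k`. By `step_lyapunov_le` it increases by at most `‖z-x*‖²/(2t_k²)` plus a
multiple of `t_k²‖F̃^k-Fx^k‖²`, even after adding `t_k(t_k-1)Λ` times the oracle increment on the
left. By `lyapunov_ge` and `μ < 2/3` it dominates multiples of `t_{k-1}²‖G‖²` and of `‖z-x*‖²`.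

The weights `τ_k` make the scaled error `Q_k = t_k(t_k-1)𝔼‖F̃^k-Fx^k‖²` contract: `Q_{k+1} ≤
(1-ε)(Q_k + (2/b)I_k) + n`, where `I_k` is the scaled increment and `n = O(σ²/b̂)` as long as `ε
t_k` stays bounded (`err_succ`, `tau_spec`). In `𝔼V_k + (B/ε)Q_k` the contraction pays for the
estimator error, and the surplus pays for the increments once `Λεb ≥ 2B` (`coupled_recursion_le`).
The remaining factors `1 + A/(k+r)²` have a bounded product.

With `K` of order `1/ε` this gives `𝔼V_K = O(1 + 1/(ε n₀) + K/(ε b̂)) = O(1)`. Hence `𝔼‖G_λ x^K‖² =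
O(1/K²)`, which is at most `ε²` for a large enough multiple of `1/ε`, at cost `n₀ + (K-1)(2b+b̂) + K
= O(ε⁻³)`. No logarithm appears, since the initial error and the accumulated noise are both `O(1)`
already. -/

namespace VFOSA

/-! ### One-point extension of nonexpansive maps -/

section Kirszbraun

variable {V : Type*} [NormedAddCommGroup V] [InnerProductSpace ℝ V]

/-- Variance identity with an arbitrary centre `y`: the subtracted square vanishes when `y` is the
barycentre and can be dropped otherwise. -/
lemma sum_sum_mul_norm_sub_sq {ι : Type*} [Fintype ι] (w : ι → ℝ) (hw : ∑ i, w i = 1)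
    (b : ι → V) (y : V) :
    ∑ i, ∑ j, w i * w j * ‖b i - b j‖ ^ 2
      = 2 * ∑ i, w i * ‖b i - y‖ ^ 2 - 2 * ‖∑ i, w i • (b i - y)‖ ^ 2 := by
  have h1 : ∀ i j, w i * w j * ‖b i - b j‖ ^ 2 = w j * (w i * ‖b i - y‖ ^ 2)
      + w i * (w j * ‖b j - y‖ ^ 2) - 2 * inner ℝ (w i • (b i - y)) (w j • (b j - y)) := by
    intro i j
    have : b i - b j = (b i - y) - (b j - y) := by abel
    rw [this, norm_sub_sq_real, real_inner_smul_left, real_inner_smul_right]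
    ring
  simp_rw [h1, Finset.sum_sub_distrib, Finset.sum_add_distrib, ← Finset.mul_sum,
    ← Finset.sum_mul, ← inner_sum, ← sum_inner, real_inner_self_eq_norm_sq, hw]
  simp only [one_mul]
  ring

/-- Duality: `φ` is the concave dual of minimising `max_i (‖y - b i‖² - ‖x - a i‖²)` over `y`. At a
maximiser `w` the barycentre `y` of the `b i` is optimal, and the variance identity, used for `b`
and for `a`, shows that the optimal value is at most zero. -/
lemma exists_norm_sub_le_of_fintype {ι : Type*} [Fintype ι] (a b : ι → V)
    (h : ∀ i j, ‖b i - b j‖ ≤ ‖a i - a j‖) (x : V) : ∃ y, ∀ i, ‖y - b i‖ ≤ ‖x - a i‖ := by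
  classical
  rcases isEmpty_or_nonempty ι with _ | _
  · exact ⟨0, fun i => isEmptyElim i⟩
  set φ : (ι → ℝ) → ℝ := fun w =>
    ∑ i, w i * (‖b i‖ ^ 2 - ‖x - a i‖ ^ 2) - ‖∑ i, w i • b i‖ ^ 2 with hφ
  have hcont : Continuous φ := by fun_prop
  obtain ⟨w, hw, hmax⟩ := (isCompact_stdSimplex ℝ ι).exists_isMaxOn
    ⟨_, single_mem_stdSimplex ℝ (Classical.arbitrary ι)⟩ hcont.continuousOn
  set y := ∑ i, w i • b i with hy
  have hw1 : ∑ i, w i = 1 := hw.2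
  have hφw : φ w ≤ 0 := by
    have e1 : ∑ i, w i * ‖b i - y‖ ^ 2 = ∑ i, w i * ‖b i‖ ^ 2 - ‖y‖ ^ 2 := by
      have : ∀ i, w i * ‖b i - y‖ ^ 2
          = w i * ‖b i‖ ^ 2 - 2 * inner ℝ (w i • b i) y + w i * ‖y‖ ^ 2 := by
        intro i; rw [norm_sub_sq_real, real_inner_smul_left]; ring
      simp_rw [this, Finset.sum_add_distrib, Finset.sum_sub_distrib, ← Finset.mul_sum,
        ← Finset.sum_mul, ← sum_inner, ← hy, real_inner_self_eq_norm_sq, hw1]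
      ring
    have e2 := sum_sum_mul_norm_sub_sq w hw1 b y
    have e3 := sum_sum_mul_norm_sub_sq w hw1 a x
    have e4 : ∑ i, w i • (b i - y) = 0 := by
      simp_rw [smul_sub, Finset.sum_sub_distrib, ← Finset.sum_smul, hw1, ← hy]; simp
    have e5 : ∑ i, ∑ j, w i * w j * ‖b i - b j‖ ^ 2 ≤ ∑ i, ∑ j, w i * w j * ‖a i - a j‖ ^ 2 := by
      refine Finset.sum_le_sum fun i _ => Finset.sum_le_sum fun j _ => ?_
      have := hw.1 i
      have := hw.1 j
      have := h i j
      gcongr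
    rw [e4, norm_zero] at e2
    have e6 : ∑ i, w i * ‖a i - x‖ ^ 2 = ∑ i, w i * ‖x - a i‖ ^ 2 := by
      simp_rw [norm_sub_rev]
    have e7 : φ w = ∑ i, w i * ‖b i - y‖ ^ 2 - ∑ i, w i * ‖x - a i‖ ^ 2 := by
      simp only [hφ, mul_sub, Finset.sum_sub_distrib]
      rw [e1, ← hy]; ring
    nlinarith [sq_nonneg ‖∑ i, w i • (a i - x)‖]
  refine ⟨y, fun i => ?_⟩
  -- Optimality of `w` along the segment towards the vertex `i`; the inequality divided by `s` has
  -- an error of order `s`.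
  have key : ∀ s ∈ Set.Ioc (0 : ℝ) 1,
      ‖y - b i‖ ^ 2 - ‖x - a i‖ ^ 2 ≤ s * ‖b i - y‖ ^ 2 := by
    intro s hs
    have hmem : (1 - s) • w + s • Pi.single i 1 ∈ stdSimplex ℝ ι :=
      convex_stdSimplex ℝ ι hw (single_mem_stdSimplex ℝ i) (by linarith [hs.2]) hs.1.le (by ring)
    have h1 : φ ((1 - s) • w + s • Pi.single i 1) ≤ φ w := hmax hmem
    have h2 : ∑ j, ((1 - s) • w + s • (Pi.single i 1 : ι → ℝ)) j • b j = y + s • (b i - y) := by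
      simp only [Pi.add_apply, Pi.smul_apply, smul_eq_mul, add_smul, Finset.sum_add_distrib,
        mul_smul, ← Finset.smul_sum, ← hy]
      rw [Finset.sum_eq_single i (by intro j _ hj; simp [hj]) (by simp)]
      simp only [Pi.single_eq_same, one_smul]
      module
    have h3 : ∑ j, ((1 - s) • w + s • (Pi.single i 1 : ι → ℝ)) j * (‖b j‖ ^ 2 - ‖x - a j‖ ^ 2)
        = (1 - s) * ∑ j, w j * (‖b j‖ ^ 2 - ‖x - a j‖ ^ 2)
          + s * (‖b i‖ ^ 2 - ‖x - a i‖ ^ 2) := by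
      simp only [Pi.add_apply, Pi.smul_apply, smul_eq_mul, add_mul, Finset.sum_add_distrib,
        mul_assoc, ← Finset.mul_sum]
      congr 2
      rw [Finset.sum_eq_single i (by intro j _ hj; simp [hj]) (by simp)]
      simp
    simp only [hφ] at h1 hφw
    rw [h2, h3, ← hy] at h1
    rw [← hy] at hφw
    rw [norm_add_sq_real, norm_smul, real_inner_smul_right, inner_sub_right,
      real_inner_self_eq_norm_sq, Real.norm_eq_abs, abs_of_pos hs.1] at h1
    rw [norm_sub_sq_real]
    have hs0 := hs.1
    have h4 : s * (‖b i‖ ^ 2 - ‖x - a i‖ ^ 2 - 2 * (inner ℝ y (b i)) + 2 * ‖y‖ ^ 2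
        - ∑ j, w j * (‖b j‖ ^ 2 - ‖x - a j‖ ^ 2)) ≤ s * (s * ‖b i - y‖ ^ 2) := by
      linarith
    have h5 := le_of_mul_le_mul_left h4 hs0
    linarith
  have h0 : ‖y - b i‖ ^ 2 - ‖x - a i‖ ^ 2 ≤ 0 := by
    by_contra hpos
    push Not at hpos
    set D := ‖y - b i‖ ^ 2 - ‖x - a i‖ ^ 2
    set N := ‖b i - y‖ ^ 2
    have hN : 0 ≤ N := by positivity
    -- An `s` small enough that the error is at most half of the supposed excess `D`; the `+ 1`
    -- avoids division by zero.
    have h1 := key (min 1 (D / (2 * (N + 1)))) ⟨by positivity, min_le_left _ _⟩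
    have h2 : min 1 (D / (2 * (N + 1))) * N ≤ D / (2 * (N + 1)) * N :=
      mul_le_mul_of_nonneg_right (min_le_right _ _) hN
    have h3 : D / (2 * (N + 1)) * N ≤ D / 2 := by
      rw [div_mul_eq_mul_div, div_le_div_iff₀ (by positivity) (by positivity)]
      nlinarith
    linarith
  exact le_of_sq_le_sq (by linarith) (norm_nonneg _)

/-- **Kirszbraun's theorem**, extension to one point. -/
lemma exists_norm_sub_le [ProperSpace V] {ι : Type*} (a b : ι → V)
    (h : ∀ i j, ‖b i - b j‖ ≤ ‖a i - a j‖) (x : V) : ∃ y, ∀ i, ‖y - b i‖ ≤ ‖x - a i‖ := by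
  classical
  rcases isEmpty_or_nonempty ι with _ | ⟨⟨i₀⟩⟩
  · exact ⟨0, fun i => isEmptyElim i⟩
  -- The wanted points form an intersection of closed balls, one of which is compact, so finite
  -- subfamilies suffice.
  have := (isCompact_closedBall (b i₀) ‖x - a i₀‖).inter_iInter_nonempty
    (fun i => Metric.closedBall (b i) ‖x - a i‖) (fun i => Metric.isClosed_closedBall) (by
      intro u
      obtain ⟨y, hy⟩ := exists_norm_sub_le_of_fintype (fun i : (insert i₀ u : Finset ι) => a i)
        (fun i => b i) (fun i j => h i j) x
      refine ⟨y, ?_, ?_⟩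
      · simpa [dist_eq_norm] using hy ⟨i₀, by simp⟩
      · simp only [Set.mem_iInter]
        intro i hi
        simpa [dist_eq_norm] using hy ⟨i, by simp [hi]⟩)
  obtain ⟨y, -, hy⟩ := this
  refine ⟨y, fun i => ?_⟩
  simpa [dist_eq_norm] using Set.mem_iInter.1 hy i

end Kirszbraun

/-! ### The resolvent of a maximally co-hypomonotone operator -/

section Operators

variable {p : ℕ} {T : E p → Set (E p)} {lam ρ : ℝ}

/-- Minty's argument. The pairs `(y + ρ u, u)` form a monotone graph, so its Cayley transform `(y +
ρ u) + c u ↦ (y + ρ u) - c u` is nonexpansive. Extending it to the point `x` yields a pair related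
to the whole graph of `T`, and maximality puts this pair in the graph. -/
lemma MaximallyCohypomonotone.resolventSet_nonempty (hT : MaximallyCohypomonotone ρ T)
    (hlam : ρ < lam) (x : E p) : (resolventSet lam T x).Nonempty := by
  set c := lam - ρ with hc
  have hc0 : 0 < c := by linarith
  obtain ⟨b, hb⟩ := exists_norm_sub_le
    (fun i : {q : E p × E p // q.2 ∈ T q.1} => (i.1.1 + ρ • i.1.2) + c • i.1.2)
    (fun i => (i.1.1 + ρ • i.1.2) - c • i.1.2) (by
      rintro ⟨⟨y, u⟩, hu⟩ ⟨⟨y', u'⟩, hu'⟩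
      have h := hT.1 y y' u u' hu hu'
      refine le_of_sq_le_sq ?_ (norm_nonneg _)
      have e1 : (y + ρ • u) - c • u - ((y' + ρ • u') - c • u')
        = ((y - y') + ρ • (u - u')) - c • (u - u') := by module
      have e2 : (y + ρ • u) + c • u - ((y' + ρ • u') + c • u')
        = ((y - y') + ρ • (u - u')) + c • (u - u') := by module
      simp only [e1, e2]
      rw [norm_add_sq_real, norm_sub_sq_real, real_inner_smul_right, inner_add_left,
        real_inner_smul_left, real_inner_self_eq_norm_sq, real_inner_comm (u - u') (y - y')]
      nlinarith) x
  -- Inversion of the Cayley transform: `x = (w + ρ v) + c v` and `b = (w + ρ v) - c v`, where `ρ +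
  -- c = lam`.
  set v := (1 / (2 * c)) • (x - b) with hv
  set w := x - lam • v with hw
  have hbv : b = x - (2 * c) • v := by
    rw [hv, smul_smul, mul_one_div, div_self (by positivity), one_smul]; abel
  have key : ∀ y u, u ∈ T y → inner ℝ (v - u) (w - y) ≥ -ρ * ‖v - u‖ ^ 2 := by
    intro y u hu
    have h1 := hb ⟨(y, u), hu⟩
    simp only at h1
    have h2 : ‖b - ((y + ρ • u) - c • u)‖ ^ 2 ≤ ‖x - ((y + ρ • u) + c • u)‖ ^ 2 := by gcongr
    have e1 : b - ((y + ρ • u) - c • u) = ((w - y) + ρ • (v - u)) - c • (v - u) := by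
      rw [hbv, hw, hc]; module
    have e2 : x - ((y + ρ • u) + c • u) = ((w - y) + ρ • (v - u)) + c • (v - u) := by
      rw [hw, hc]; module
    rw [e1, e2, norm_add_sq_real, norm_sub_sq_real, real_inner_smul_right, inner_add_left,
        real_inner_smul_left, real_inner_self_eq_norm_sq, real_inner_comm (v - u) (w - y)] at h2
    have h3 : 0 ≤ c * (inner ℝ (v - u) (w - y) + ρ * ‖v - u‖ ^ 2) := by linarith
    have h4 := nonneg_of_mul_nonneg_right h3 hc0
    linarith
  have hT' := hT.2 (fun y => T y ∪ {u | y = w ∧ u = v}) (by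
    rintro y y' u u' (hu | ⟨rfl, rfl⟩) (hu' | ⟨rfl, rfl⟩)
    · exact hT.1 y y' u u' hu hu'
    · have := key y u hu
      rw [← neg_sub, ← neg_sub _ y, inner_neg_neg, norm_neg]
      exact this
    · exact key y' u' hu'
    · simp) (fun y => Set.subset_union_left)
  refine ⟨w, v, ?_, by rw [hw]; abel⟩
  rw [← hT']
  exact Or.inr ⟨rfl, rfl⟩

lemma MaximallyCohypomonotone.resolvent_mem (hT : MaximallyCohypomonotone ρ T)
    (hlam : ρ < lam) (x : E p) : resolvent lam T x ∈ resolventSet lam T x := by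
  have h := hT.resolventSet_nonempty hlam x
  rw [resolvent, dif_pos h]
  exact h.some_mem

/-- Expanding `‖(w - w') + λ(u - u')‖²` leaves `‖w - w'‖²` plus at least `λ(λ - 2ρ)‖u - u'‖²`. -/
lemma norm_sub_le_of_mem_resolventSet (hT : Cohypomonotone ρ T) (hlam0 : 0 ≤ lam)
    (hlam : 2 * ρ ≤ lam) {x y w w' : E p} (hw : w ∈ resolventSet lam T x)
    (hw' : w' ∈ resolventSet lam T y) : ‖w - w'‖ ≤ ‖x - y‖ := by
  obtain ⟨u, hu, rfl⟩ := hw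
  obtain ⟨u', hu', rfl⟩ := hw'
  have h := hT w w' u u' hu hu'
  refine le_of_sq_le_sq ?_ (norm_nonneg _)
  have e : w + lam • u - (w' + lam • u') = (w - w') + lam • (u - u') := by module
  rw [e, norm_add_sq_real, real_inner_smul_right, norm_smul, real_inner_comm, mul_pow,
    Real.norm_eq_abs, sq_abs]
  have h1 : lam * (-ρ * ‖u - u'‖ ^ 2) ≤ lam * inner ℝ (u - u') (w - w') := by gcongr
  have h2 : 0 ≤ lam * (lam - 2 * ρ) * ‖u - u'‖ ^ 2 :=
    mul_nonneg (mul_nonneg hlam0 (by linarith)) (by positivity)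
  nlinarith

lemma MaximallyCohypomonotone.norm_resolvent_sub_le (hT : MaximallyCohypomonotone ρ T)
    (hlam0 : 0 < lam) (hlam : 2 * ρ ≤ lam) (x y : E p) :
    ‖resolvent lam T x - resolvent lam T y‖ ≤ ‖x - y‖ := by
  have hl : ρ < lam := by linarith
  exact norm_sub_le_of_mem_resolventSet hT.1 hlam0.le hlam (hT.resolvent_mem hl x)
    (hT.resolvent_mem hl y)

lemma MaximallyCohypomonotone.resolvent_eq (hT : MaximallyCohypomonotone ρ T)
    (hlam0 : 0 < lam) (hlam : 2 * ρ ≤ lam) {x w : E p}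
    (hw : w ∈ resolventSet lam T x) : resolvent lam T x = w := by
  have := norm_sub_le_of_mem_resolventSet hT.1 hlam0.le hlam
    (hT.resolvent_mem (by linarith) x) hw
  rw [sub_self, norm_zero] at this
  exact sub_eq_zero.1 (norm_le_zero_iff.1 this)

/-- This places the residual on the graph of `T`, at the forward-backward point, so that
co-hypomonotonicity can be applied to it. -/
lemma MaximallyCohypomonotone.residual_sub_mem (hT : MaximallyCohypomonotone ρ T)
    (hlam0 : 0 < lam) (hlam : ρ < lam) (F : E p → E p) (x : E p) :
    residual lam F T x - F x ∈ T (x - lam • residual lam F T x) := by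
  obtain ⟨v, hv, h⟩ := hT.resolvent_mem hlam (x - lam • F x)
  have e1 : x - resolvent lam T (x - lam • F x) = lam • (F x + v) := by
    rw [smul_add, sub_eq_iff_eq_add]
    rw [sub_eq_iff_eq_add] at h
    nth_rw 1 [h]; abel
  have e2 : residual lam F T x = F x + v := by
    rw [residual, e1, smul_smul, one_div, inv_mul_cancel₀ hlam0.ne', one_smul]
  have e3 : x - lam • residual lam F T x = resolvent lam T (x - lam • F x) := by
    rw [e2, ← e1]; abel
  rw [e3, e2]; simpa using hv

lemma MaximallyCohypomonotone.residual_eq_zero (hT : MaximallyCohypomonotone ρ T)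
    (hlam0 : 0 < lam) (hlam : 2 * ρ ≤ lam) {F : E p → E p} {xs : E p}
    (hxs : xs ∈ zer (sumOp F T)) : residual lam F T xs = 0 := by
  obtain ⟨v, hv, h⟩ := hxs
  have hFv : F xs = -v := eq_neg_of_add_eq_zero_left h
  rw [residual, hT.resolvent_eq hlam0 hlam (w := xs) ⟨v, hv, by rw [hFv]; simp⟩]
  simp

end Operators

/-! ### Consequences of the problem assumptions -/

section Setting

variable {p : ℕ} {Ξ : Type*} [MeasurableSpace Ξ] {P : Measure Ξ} {bF : E p → Ξ → E p}
  {F : E p → E p} {T : E p → Set (E p)} {L Lhat ρ σ lam : ℝ}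

/-- The mean-square increment `𝔼 ‖bF(x, ξ) - bF(y, ξ)‖²` of the oracle. -/
noncomputable def increment (P : Measure Ξ) (bF : E p → Ξ → E p) (x y : E p) : ℝ :=
  ∫ ξ, ‖bF x ξ - bF y ξ‖ ^ 2 ∂P

lemma increment_nonneg (x y : E p) : 0 ≤ increment P bF x y :=
  integral_nonneg fun _ => by positivity

lemma ExpectationSetting.measurable_bF (h : ExpectationSetting P bF F T L ρ σ) (x : E p) :
    Measurable (bF x) := h.measurable_oracle.comp measurable_prodMk_left

lemma ExpectationSetting.memLp (h : ExpectationSetting P bF F T L ρ σ) [IsFiniteMeasure P]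
    (x : E p) : MemLp (bF x) 2 P := by
  have h1 : MemLp (fun ξ => bF x ξ - F x) 2 P :=
    (memLp_two_iff_integrable_sq_norm
      ((h.measurable_bF x).sub_const _).aestronglyMeasurable).2 (h.integrable_variance x)
  have h2 := h1.add (memLp_const (F x))
  have e : ((fun ξ => bF x ξ - F x) + fun _ => F x) = bF x := by ext1 ξ; simp
  rwa [e] at h2

/-- The variance of `bF x ξ - bF y ξ` is nonnegative. -/
lemma ExpectationSetting.norm_sub_sq_le_increment (h : ExpectationSetting P bF F T L ρ σ)
    [IsProbabilityMeasure P] (x y : E p) : ‖F x - F y‖ ^ 2 ≤ increment P bF x y := by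
  have hm : MemLp (fun ξ => bF x ξ - bF y ξ) 2 P := (h.memLp x).sub (h.memLp y)
  have h0 : ∫ ξ, bF x ξ - bF y ξ ∂P = F x - F y := by
    rw [integral_sub (h.integrable_oracle x) (h.integrable_oracle y), h.unbiased, h.unbiased]
  have hi := hm.integrable_norm_pow two_ne_zero
  have h1 : 0 ≤ ∫ ξ, ‖(bF x ξ - bF y ξ) - (F x - F y)‖ ^ 2 ∂P :=
    integral_nonneg fun _ => by positivity
  simp_rw [norm_sub_sq_real _ (F x - F y), real_inner_comm (F x - F y)] at h1
  have hint : Integrable (fun ξ => bF x ξ - bF y ξ) P := hm.integrable one_le_two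
  have h2 : Integrable (fun ξ => 2 * inner ℝ (F x - F y) (bF x ξ - bF y ξ)) P :=
    (hint.const_inner _).const_mul 2
  rw [integral_add (by exact hi.sub h2) (integrable_const _), integral_sub hi h2, integral_const_mul,
    integral_inner hint, h0, real_inner_self_eq_norm_sq] at h1
  simp only [integral_const, probReal_univ, smul_eq_mul, one_mul] at h1
  unfold increment
  linarith

lemma ExpectationSetting.norm_sub_le (h : ExpectationSetting P bF F T L ρ σ) (hL : 0 < L)
    [IsProbabilityMeasure P] (x y : E p) : ‖F x - F y‖ ≤ L * ‖x - y‖ := by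
  have h1 := h.norm_sub_sq_le_increment x y
  have h2 := h.cocoercive x y
  have h3 := real_inner_le_norm (F x - F y) (x - y)
  have h4 : 1 / L * ‖F x - F y‖ ^ 2 ≤ ‖F x - F y‖ * ‖x - y‖ :=
    (mul_le_mul_of_nonneg_left h1 (by positivity)).trans (h2.le.trans h3)
  rw [one_div, inv_mul_le_iff₀ hL] at h4
  rcases (norm_nonneg (F x - F y)).eq_or_lt with h0 | h0
  · rw [← h0]; positivity
  · have : ‖F x - F y‖ * ‖F x - F y‖ ≤ ‖F x - F y‖ * (L * ‖x - y‖) := by linarith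
    exact le_of_mul_le_mul_left this h0

/-- Serves to make the increments along the iterates integrable. -/
lemma ExpectationSetting.increment_le (h : ExpectationSetting P bF F T L ρ σ) (hL : 0 < L)
    [IsProbabilityMeasure P] (x y : E p) : increment P bF x y ≤ L ^ 2 * ‖x - y‖ ^ 2 := by
  have h1 := h.norm_sub_le hL x y
  have h2 := h.cocoercive x y
  have h3 := real_inner_le_norm (F x - F y) (x - y)
  have h4 : 1 / L * increment P bF x y ≤ L * ‖x - y‖ * ‖x - y‖ :=
    h2.le.trans (h3.trans (by gcongr))
  rw [one_div, inv_mul_le_iff₀ hL] at h4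
  linarith

lemma ExpectationSetting.continuous (h : ExpectationSetting P bF F T L ρ σ) (hL : 0 < L)
    [IsProbabilityMeasure P] : Continuous F :=
  (LipschitzWith.of_dist_le_mul (K := ⟨L, hL.le⟩) fun x y => by
    rw [dist_eq_norm, dist_eq_norm]; exact h.norm_sub_le hL x y).continuous

lemma continuous_of_norm_sub_le {f : E p → E p} (hf : ∀ x y, ‖f x - f y‖ ≤ ‖x - y‖) :
    Continuous f :=
  (LipschitzWith.of_dist_le_mul (K := 1) fun x y => by
    simpa [dist_eq_norm] using hf x y).continuous

/-- Co-hypomonotonicity at the two forward-backward points bounds `⟨g, d⟩` below by `⟨f, d⟩` plus a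
quadratic form in `g`, `f`. Only the part `1/L̂` of the co-coercivity constant `1/L` is spent on
minimising that form over `f`; the rest is kept as the surplus in the increment. -/
lemma ExpectationSetting.residual_cocoercive (h : ExpectationSetting P bF F T L ρ σ)
    [IsProbabilityMeasure P] (hL : 0 < L) (hLhat : L < Lhat) (hLρ : Lhat * ρ < 1)
    (hlam0 : 0 < lam) (hlam : 2 * ρ ≤ lam) (x y : E p) :
    betaBar lam Lhat ρ * ‖residual lam F T x - residual lam F T y‖ ^ 2
        + (1 / L - 1 / Lhat) * increment P bF x y
      ≤ inner ℝ (residual lam F T x - residual lam F T y) (x - y) := by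
  have hLh : 0 < Lhat := hL.trans hLhat
  have h1 := h.cohypomonotone.1 _ _ _ _
    (h.cohypomonotone.residual_sub_mem hlam0 (by linarith) F x)
    (h.cohypomonotone.residual_sub_mem hlam0 (by linarith) F y)
  have h2 := h.cocoercive x y
  have h3 := h.norm_sub_sq_le_increment x y
  change _ ≥ (1 / L) * increment P bF x y at h2
  set g := residual lam F T x - residual lam F T y with hg
  set f := F x - F y with hf
  set d := x - y with hd
  have e1 : residual lam F T x - F x - (residual lam F T y - F y) = g - f := by
    rw [hg, hf]; abel
  have e2 : x - lam • residual lam F T x - (y - lam • residual lam F T y) = d - lam • g := by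
    rw [hg, hd]; module
  rw [e1, e2] at h1
  clear_value g f d
  rw [norm_sub_sq_real, inner_sub_right, inner_sub_left, real_inner_smul_right, inner_sub_left,
    real_inner_self_eq_norm_sq, real_inner_comm g f] at h1
  have hk : 0 < 1 / Lhat - ρ := by
    rw [sub_pos, lt_div_iff₀ hLh]; linarith
  have h4 : 1 / Lhat * ‖f‖ ^ 2 ≤ 1 / Lhat * increment P bF x y := by gcongr
  -- `betaBar` is the coefficient of `‖g‖²` that remains after completing the square in `f`.
  have hb : betaBar lam Lhat ρ
      = lam - ρ - (lam - 2 * ρ) ^ 2 / (4 * (1 / Lhat - ρ)) := by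
    have : 1 - ρ * Lhat ≠ 0 := by linarith
    have : 1 - Lhat * ρ ≠ 0 := by linarith
    have e : 1 / Lhat - ρ = (1 - ρ * Lhat) / Lhat := by field_simp
    rw [betaBar, e]; field_simp; ring
  have h5 : 0 ≤ ‖(lam - 2 * ρ) • g - (2 * (1 / Lhat - ρ)) • f‖ ^ 2 := by positivity
  rw [norm_sub_sq_real, norm_smul, norm_smul, real_inner_smul_left, real_inner_smul_right,
    mul_pow, mul_pow, Real.norm_eq_abs, Real.norm_eq_abs, sq_abs, sq_abs] at h5
  have h6 : (lam - 2 * ρ) * inner ℝ g f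
      ≤ (lam - 2 * ρ) ^ 2 / (4 * (1 / Lhat - ρ)) * ‖g‖ ^ 2 + (1 / Lhat - ρ) * ‖f‖ ^ 2 := by
    rw [div_mul_eq_mul_div, ← sub_le_iff_le_add, le_div_iff₀ (by positivity)]
    linarith
  rw [hb]
  linarith

/-- The residual computed from a value `f` in place of `F x`. -/
noncomputable def approxResidual (lam : ℝ) (T : E p → Set (E p)) (x f : E p) : E p :=
  (1 / lam) • (x - resolvent lam T (x - lam • f))

lemma norm_approxResidual_sub_le (hT : MaximallyCohypomonotone ρ T) (hlam0 : 0 < lam)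
    (hlam : 2 * ρ ≤ lam) (x f : E p) :
    ‖approxResidual lam T x f - residual lam F T x‖ ≤ ‖f - F x‖ := by
  have h := hT.norm_resolvent_sub_le hlam0 hlam (x - lam • F x) (x - lam • f)
  have e1 : approxResidual lam T x f - residual lam F T x
      = (1 / lam) • (resolvent lam T (x - lam • F x) - resolvent lam T (x - lam • f)) := by
    rw [approxResidual, residual]; module
  have e2 : x - lam • F x - (x - lam • f) = lam • (f - F x) := by module
  rw [e2, norm_smul, Real.norm_of_nonneg hlam0.le] at h
  rw [e1, norm_smul, Real.norm_of_nonneg (by positivity), one_div, inv_mul_le_iff₀ hlam0]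
  exact h

end Setting

/-! ### One step of the accelerated scheme -/

section Step

variable {V : Type*} [NormedAddCommGroup V] [InnerProductSpace ℝ V]

lemma real_inner_le_young (a b : V) {c : ℝ} (hc : 0 < c) :
    2 * inner ℝ a b ≤ c * ‖a‖ ^ 2 + ‖b‖ ^ 2 / c := by
  have h := real_inner_le_norm a b
  have h1 : 0 ≤ (c * ‖a‖ - ‖b‖) ^ 2 / c := by positivity
  have h2 : (c * ‖a‖ - ‖b‖) ^ 2 / c = c * ‖a‖ ^ 2 - 2 * (‖a‖ * ‖b‖) + ‖b‖ ^ 2 / c := by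
    field_simp
    ring
  linarith

lemma neg_real_inner_le_young (a b : V) {c : ℝ} (hc : 0 < c) :
    -(2 * inner ℝ a b) ≤ c * ‖a‖ ^ 2 + ‖b‖ ^ 2 / c := by
  simpa using real_inner_le_young (-a) b hc

/-- The displacement `x' - x` is written in two ways: through the old anchor gap `x - z`, paired
with `G`, and through the new gap `x' - z'`, paired with `G'`. This produces the inner-product terms
of the Lyapunov function at both times. -/
lemma step_inner_eq {β ν η t : ℝ} {x z G G' g x' z' y : V} (ht : 1 < t) (htν : 0 < t - ν)
    (hη : η = 2 * β * (t - 1) / (t - ν)) (hy : y = ((t - 1) / t) • x + (1 / t) • z)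
    (hx' : x' = y - η • g) (hz' : z' = z + ν • (x' - y)) :
    t * (t - 1) * inner ℝ (G' - G) (x' - x)
      = -(t * inner ℝ G' (x' - z')) - 2 * β * (t * (t - 1)) * inner ℝ G' g
        + (t - 1) * inner ℝ G (x - z) + η * (t * (t - 1)) * inner ℝ G g := by
  have ht0 : 0 < t := by linarith
  have ht1 : t - 1 ≠ 0 := by linarith
  have e2 : x' - x = -((1 / t) • (x - z)) - η • g := by
    rw [hx', hy]
    have : (t - 1) / t = 1 - 1 / t := by field_simp
    rw [this]; module
  have e1 : x' - x = -((1 / (t - 1)) • (x' - z')) - (2 * β) • g := by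
    have : x - z = (t / (t - 1)) • ((x' - z') + ((1 - ν) * η) • g) := by
      have h1 : (x' - z') + ((1 - ν) * η) • g = ((t - 1) / t) • (x - z) := by
        rw [hz', hx', hy]
        have : (1 / t) = 1 - (t - 1) / t := by field_simp; ring
        rw [this]; module
      rw [h1, smul_smul, div_mul_div_cancel₀ ht1, div_self ht0.ne', one_smul]
    rw [e2, this, smul_smul]
    have h3 : 1 / t * (t / (t - 1)) = 1 / (t - 1) := by field_simp
    -- This identity dictates the formula for `η`: the coefficient of `g` in the second form is then
    -- the constant `2β`.
    have h4 : 2 * β = 1 / (t - 1) * ((1 - ν) * η) + η := by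
      rw [hη]
      field_simp; ring
    rw [h3, h4]; module
  rw [inner_sub_left]
  nth_rw 1 [e1]
  rw [e2, inner_sub_right, inner_sub_right, inner_neg_right, inner_neg_right,
    real_inner_smul_right, real_inner_smul_right, real_inner_smul_right, real_inner_smul_right]
  field_simp
  ring

/-- The Young weight `2 - 3μ` is the largest part of the available `2 - μ` copies of `‖G‖²` that
still leaves the `2μ` needed later; it is positive as `μ < 2/3`. -/
lemma neg_mul_inner_le_young {β μ ν W t : ℝ} (G e : V) (hν : ν = μ / 2) (hμ : 0 < μ)
    (hμ' : μ < 2 / 3) (hβ : 0 < β) (hW0 : 0 ≤ W) (hWt : W ≤ t) (ht : 1 < t) :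
    β * W * (-(2 * ((1 - ν) * inner ℝ G e)))
      ≤ β * W * ((2 - 3 * μ) * ‖G‖ ^ 2) + β / (2 - 3 * μ) * t ^ 2 * ‖e‖ ^ 2 := by
  have h23 : 0 < 2 - 3 * μ := by linarith
  have y2 := neg_real_inner_le_young G ((1 - ν) • e) h23
  have hν1 : 0 ≤ 1 - ν := by linarith
  rw [real_inner_smul_right, norm_smul, Real.norm_of_nonneg hν1] at y2
  have h1 : ((1 - ν) * ‖e‖) ^ 2 / (2 - 3 * μ) ≤ ‖e‖ ^ 2 / (2 - 3 * μ) := by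
    gcongr
    exact mul_le_of_le_one_left (norm_nonneg e) (by linarith)
  have h2 := mul_le_mul_of_nonneg_left (y2.trans (add_le_add_right h1 _))
    (mul_nonneg hβ.le hW0)
  have hWt2 : W ≤ t ^ 2 := by nlinarith
  have h3 : β * W * (‖e‖ ^ 2 / (2 - 3 * μ)) ≤ β * t ^ 2 * (‖e‖ ^ 2 / (2 - 3 * μ)) := by
    gcongr
  have h4 : β * t ^ 2 * (‖e‖ ^ 2 / (2 - 3 * μ)) = β / (2 - 3 * μ) * t ^ 2 * ‖e‖ ^ 2 := by
    field_simp
  linarith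

/-- The quadratic part of the estimate, from the co-coercivity between consecutive iterates. -/
lemma step_residual_le {β γ μ ν η t Λe : ℝ} {x z G G' e x' z' y : V}
    (hν : ν = μ / 2) (hμ : 0 < μ) (hμ' : μ < 2 / 3) (hβ : 0 < β) (hγβ : β < γ)
    (ht : 1 < t) (hη : η = 2 * β * (t - 1) / (t - ν))
    (hy : y = ((t - 1) / t) • x + (1 / t) • z) (hx' : x' = y - η • (G + e))
    (hz' : z' = z + ν • (x' - y))
    (hco : γ * ‖G' - G‖ ^ 2 + Λe ≤ inner ℝ (G' - G) (x' - x)) :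
    t * (t - 1) * β * ‖G'‖ ^ 2 + t * inner ℝ G' (x' - z') + t * (t - 1) * Λe
      ≤ t * (t - 1) * β * ‖G‖ ^ 2 + (t - 1) * inner ℝ G (x - z) - 2 * μ * β * (t - 1) * ‖G‖ ^ 2
        + (β ^ 2 / (γ - β) + β / (2 - 3 * μ)) * t ^ 2 * ‖e‖ ^ 2 := by
  have htν : 0 < t - ν := by linarith
  have h1 := step_inner_eq (G := G) (G' := G') ht htν hη hy hx' hz'
  -- `W` measures how far `η` is from `2β`; it lies between `t - 1` and `t`.
  set W := t * (t - 1) / (t - ν) with hW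
  have hηW : η * (t * (t - 1)) = 2 * β * (t * (t - 1)) - 2 * β * (1 - ν) * W := by
    rw [hη, hW]; field_simp; ring
  have hWt : W ≤ t := by
    rw [hW, div_le_iff₀ htν]; nlinarith
  have hWt1 : t - 1 ≤ W := by
    rw [hW, le_div_iff₀ htν]; nlinarith
  have hW0 : 0 ≤ W := by linarith
  have y2' := neg_mul_inner_le_young G e hν hμ hμ' hβ hW0 hWt ht
  have htt : 0 ≤ t * (t - 1) := mul_nonneg (by linarith) (by linarith)
  -- Of `γ‖G' - G‖²`, the part `β` completes the square in `G`, `G'`; the part `γ - β` absorbs the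
  -- estimator error.
  have y1 := neg_real_inner_le_young (G' - G) (β • e) (sub_pos.2 hγβ)
  rw [real_inner_smul_right, norm_smul, Real.norm_of_nonneg hβ.le] at y1
  have y1' : t * (t - 1) * (-(2 * (β * inner ℝ (G' - G) e)))
      ≤ t * (t - 1) * ((γ - β) * ‖G' - G‖ ^ 2) + β ^ 2 / (γ - β) * t ^ 2 * ‖e‖ ^ 2 := by
    have h0 : 0 < γ - β := by linarith
    have htt' : t * (t - 1) ≤ t ^ 2 := by nlinarith
    have h3 : t * (t - 1) * ((β * ‖e‖) ^ 2 / (γ - β)) ≤ t ^ 2 * ((β * ‖e‖) ^ 2 / (γ - β)) := by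
      gcongr
    have h4 : t ^ 2 * ((β * ‖e‖) ^ 2 / (γ - β)) = β ^ 2 / (γ - β) * t ^ 2 * ‖e‖ ^ 2 := by
      field_simp
    have := mul_le_mul_of_nonneg_left y1 htt
    linarith
  have h5 := mul_le_mul_of_nonneg_left hco htt
  have h6 : β * (t - 1) * (2 * μ * ‖G‖ ^ 2) ≤ β * W * (2 * μ * ‖G‖ ^ 2) := by gcongr
  rw [h1, hηW, inner_add_right, inner_add_right, real_inner_self_eq_norm_sq] at h5
  rw [inner_sub_left] at y1'
  rw [norm_sub_sq_real] at h5 y1'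
  have h7 : 2 * β * (1 - ν) * W * ‖G‖ ^ 2 = β * W * (2 - μ) * ‖G‖ ^ 2 := by
    rw [hν]; ring
  rw [real_inner_comm G G'] at h5 y1'
  generalize inner ℝ G' e = i1 at *
  generalize inner ℝ G e = i2 at *
  generalize inner ℝ G G' = i3 at *
  generalize inner ℝ G' (x' - z') = i4 at *
  generalize inner ℝ G (x - z) = i5 at *
  generalize ‖G‖ ^ 2 = n1 at *
  generalize ‖G'‖ ^ 2 = n2 at *
  generalize ‖e‖ ^ 2 = n3 at *
  linarith

/-- The anchor part of the estimate. -/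
lemma step_anchor_le {β γ μ ν η t w : ℝ} {x z G e z' xs : V}
    (hν : ν = μ / 2) (hμ : 0 < μ) (hμ' : μ < 2 / 3) (hβ : 0 < β) (hγβ : (1 + μ) * β ≤ γ)
    (ht : 1 < t) (hη : 0 < η) (hη' : η ≤ 2 * β) (hw : 2 * ν * η * w = 1 - μ)
    (hz' : z' = z - (ν * η) • (G + e)) (hco : γ * ‖G‖ ^ 2 ≤ inner ℝ G (x - xs)) :
    w * ‖z' - xs‖ ^ 2
      ≤ w * ‖z - xs‖ ^ 2 + (1 - μ) * inner ℝ G (x - z) - (1 - μ) * β * ‖G‖ ^ 2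
        + 1 / (2 * t ^ 2) * ‖z - xs‖ ^ 2 + (1 / 2 + 2 * β) * t ^ 2 * ‖e‖ ^ 2 := by
  have ht0 : 0 < t := by linarith
  have hν0 : 0 < ν := by linarith
  have h1 : w * ‖z' - xs‖ ^ 2 = w * ‖z - xs‖ ^ 2 - (1 - μ) * inner ℝ (G + e) (z - xs)
      + (1 - μ) * (ν * η / 2) * ‖G + e‖ ^ 2 := by
    have : z' - xs = (z - xs) - (ν * η) • (G + e) := by rw [hz']; abel
    rw [this, norm_sub_sq_real, real_inner_smul_right, norm_smul, mul_pow, Real.norm_eq_abs,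
      sq_abs, ← hw, real_inner_comm]
    ring
  have h2 : inner ℝ G (z - xs) = inner ℝ G (x - xs) - inner ℝ G (x - z) := by
    rw [← inner_sub_right]; congr 1; abel
  -- The weight `t ^ 2` puts a summable factor `1 / t ^ 2` on `‖z - xs‖²` and matches the scaling of
  -- the squared error.
  have h3 := neg_real_inner_le_young e (z - xs) (c := t ^ 2) (by positivity)
  have h4 : ‖G + e‖ ^ 2 ≤ 2 * ‖G‖ ^ 2 + 2 * ‖e‖ ^ 2 := by
    have := parallelogram_law_with_norm ℝ G e
    nlinarith [norm_nonneg (G - e)]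
  have hμ1 : 0 < 1 - μ := by linarith
  have h5 : (1 - μ) * (ν * η / 2) * ‖G + e‖ ^ 2
      ≤ (1 - μ) * (ν * η / 2) * (2 * ‖G‖ ^ 2 + 2 * ‖e‖ ^ 2) := by gcongr
  have hνη : ν * η ≤ μ * β := by rw [hν]; nlinarith
  have h6 : (1 - μ) * (ν * η) * ‖G‖ ^ 2 ≤ (1 - μ) * (μ * β) * ‖G‖ ^ 2 := by gcongr
  have h7 : (1 - μ) * (ν * η) * ‖e‖ ^ 2 ≤ 2 * β * t ^ 2 * ‖e‖ ^ 2 := by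
    have : (1 - μ) * (ν * η) ≤ 1 * (μ * β) := by gcongr; linarith
    have : 1 * (μ * β) ≤ 2 * β * 1 := by nlinarith
    have : 2 * β * 1 ≤ 2 * β * t ^ 2 := by gcongr; nlinarith
    exact mul_le_mul_of_nonneg_right (by linarith) (by positivity)
  have h8 : (1 - μ) * ((1 + μ) * β * ‖G‖ ^ 2) ≤ (1 - μ) * inner ℝ G (x - xs) := by
    gcongr
    exact (by gcongr : (1 + μ) * β * ‖G‖ ^ 2 ≤ γ * ‖G‖ ^ 2).trans hco
  have h9 : (1 - μ) * (t ^ 2 * ‖e‖ ^ 2 + ‖z - xs‖ ^ 2 / t ^ 2)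
      ≤ 1 * (t ^ 2 * ‖e‖ ^ 2 + ‖z - xs‖ ^ 2 / t ^ 2) := by gcongr; linarith
  have h10 := mul_le_mul_of_nonneg_left h3 hμ1.le
  have h11 : 1 / (2 * t ^ 2) * ‖z - xs‖ ^ 2 = ‖z - xs‖ ^ 2 / t ^ 2 / 2 := by field_simp
  rw [h1, inner_add_left, h2, h11]
  linarith

/-- Decrease of the Lyapunov function in one step, up to the error of the estimator. -/
lemma step_lyapunov_le {β γ μ ν η t w w' Λe : ℝ} {x z G G' e x' z' y xs : V}
    (hν : ν = μ / 2) (hμ : 0 < μ) (hμ' : μ < 2 / 3) (hβ : 0 < β) (hγβ : (1 + μ) * β ≤ γ)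
    (ht : 1 < t) (hη : η = 2 * β * (t - 1) / (t - ν))
    (hw : 2 * ν * η * w = 1 - μ) (hw' : w' ≤ w)
    (hy : y = ((t - 1) / t) • x + (1 / t) • z) (hx' : x' = y - η • (G + e))
    (hz' : z' = z + ν • (x' - y))
    (hco : γ * ‖G' - G‖ ^ 2 + Λe ≤ inner ℝ (G' - G) (x' - x))
    (hco0 : γ * ‖G‖ ^ 2 ≤ inner ℝ G (x - xs)) :
    t * (t - 1) * β * ‖G'‖ ^ 2 + t * inner ℝ G' (x' - z') + w' * ‖z' - xs‖ ^ 2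
        + t * (t - 1) * Λe
      ≤ (t - μ) * (t - μ - 1) * β * ‖G‖ ^ 2 + (t - μ) * inner ℝ G (x - z) + w * ‖z - xs‖ ^ 2
        + 1 / (2 * t ^ 2) * ‖z - xs‖ ^ 2
        + (β ^ 2 / (γ - β) + β / (2 - 3 * μ) + 1 / 2 + 2 * β) * t ^ 2 * ‖e‖ ^ 2 := by
  have htν : 0 < t - ν := by linarith
  have hη0 : 0 < η := by
    rw [hη]; exact div_pos (mul_pos (by positivity) (by linarith)) htν
  have hη1 : η ≤ 2 * β := by
    rw [hη, div_le_iff₀ htν]; nlinarith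
  have h1 := step_residual_le hν hμ hμ' hβ (by nlinarith) ht hη hy hx' hz' hco
  have h2 := step_anchor_le (z' := z') (e := e) hν hμ hμ' hβ hγβ ht hη0 hη1 hw
    (by rw [hz', hx']; module) hco0
  have h3 : w' * ‖z' - xs‖ ^ 2 ≤ w * ‖z' - xs‖ ^ 2 := by gcongr
  -- The exact gap between `(t - μ)(t - μ - 1)` and the coefficient `t(t - 1) - 2μ(t - 1) - (1 - μ)`
  -- obtained from the two parts is `(1 - μ)²`.
  have h4 : 0 ≤ (1 - μ) ^ 2 * β * ‖G‖ ^ 2 := by positivity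
  nlinarith

/-- The Lyapunov function dominates the residual and the distance of the anchor. -/
lemma lyapunov_ge {β γ s w a : ℝ} {x z G xs : V} (hβγ : β ≤ γ) (hs : 0 ≤ s) (ha : 0 < a)
    (hco0 : γ * ‖G‖ ^ 2 ≤ inner ℝ G (x - xs)) :
    (β - a) * s ^ 2 * ‖G‖ ^ 2 + (w - 1 / (4 * a)) * ‖z - xs‖ ^ 2
      ≤ s * (s - 1) * β * ‖G‖ ^ 2 + s * inner ℝ G (x - z) + w * ‖z - xs‖ ^ 2 := by
  have h2 : inner ℝ G (x - z) = inner ℝ G (x - xs) - inner ℝ G (z - xs) := by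
    rw [← inner_sub_right]; congr 1; abel
  -- The parameter `a` decides how much of `β s² ‖G‖²` is given up to control the cross term with
  -- the anchor.
  have h3 := real_inner_le_young (s • G) (z - xs) (c := 2 * a) (by positivity)
  rw [real_inner_smul_left, norm_smul, Real.norm_of_nonneg hs] at h3
  have h4 : s * (β * ‖G‖ ^ 2) ≤ s * inner ℝ G (x - xs) := by
    gcongr
    exact (by gcongr : β * ‖G‖ ^ 2 ≤ γ * ‖G‖ ^ 2).trans hco0
  have h5 : ‖z - xs‖ ^ 2 / (2 * a) = 2 * (1 / (4 * a) * ‖z - xs‖ ^ 2) := by field_simp; ring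
  rw [h2]
  rw [h5] at h3
  nlinarith

end Step

/-! ### Square-integrable vectors and independent noise -/

section Probability

lemma integrable_inner_of_memLp {Ω : Type*} {_ : MeasurableSpace Ω} {Pr : Measure Ω} {p : ℕ}
    {f g : Ω → E p} (hf : MemLp f 2 Pr) (hg : MemLp g 2 Pr) :
    Integrable (fun ω => inner ℝ (f ω) (g ω)) Pr := by
  refine ((hf.integrable_norm_pow two_ne_zero).add (hg.integrable_norm_pow two_ne_zero)).mono'
    (hf.1.inner hg.1) (.of_forall fun ω => ?_)
  have h := abs_real_inner_le_norm (f ω) (g ω)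
  simp only [Pi.add_apply, Real.norm_eq_abs]
  nlinarith [sq_nonneg (‖f ω‖ - ‖g ω‖), norm_nonneg (f ω), norm_nonneg (g ω)]

lemma integrable_norm_sq_of_memLp {Ω : Type*} {_ : MeasurableSpace Ω} {Pr : Measure Ω} {p : ℕ}
    {f : Ω → E p} (hf : MemLp f 2 Pr) : Integrable (fun ω => ‖f ω‖ ^ 2) Pr :=
  hf.integrable_norm_pow two_ne_zero

lemma integral_norm_add_sq {Ω : Type*} {_ : MeasurableSpace Ω} {Pr : Measure Ω} {p : ℕ}
    {f g : Ω → E p} (hf : MemLp f 2 Pr) (hg : MemLp g 2 Pr) :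
    ∫ ω, ‖f ω + g ω‖ ^ 2 ∂Pr
      = ∫ ω, ‖f ω‖ ^ 2 ∂Pr + 2 * ∫ ω, inner ℝ (f ω) (g ω) ∂Pr + ∫ ω, ‖g ω‖ ^ 2 ∂Pr := by
  have h1 := integrable_norm_sq_of_memLp hf
  have h2 := (integrable_inner_of_memLp hf hg).const_mul 2
  simp_rw [norm_add_sq_real]
  rw [integral_add (by exact h1.add h2) (integrable_norm_sq_of_memLp hg), integral_add h1 h2,
    integral_const_mul]

lemma memLp_of_norm_le_add {Ω : Type*} {_ : MeasurableSpace Ω} {Pr : Measure Ω} {p : ℕ}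
    [IsFiniteMeasure Pr] {f : Ω → E p} {g : Ω → E p} (hf : AEStronglyMeasurable f Pr)
    (hg : MemLp g 2 Pr) (C D : ℝ) (h : ∀ ω, ‖f ω‖ ≤ C + D * ‖g ω‖) : MemLp f 2 Pr :=
  ((memLp_const C).add (hg.norm.const_mul D)).mono' hf (.of_forall h)

lemma integral_eval_comp {Ξ G ι : Type*} [MeasurableSpace Ξ] [Fintype ι] {P : Measure Ξ}
    [IsProbabilityMeasure P] [NormedAddCommGroup G] [NormedSpace ℝ G] [MeasurableSpace G]
    [BorelSpace G] [SecondCountableTopology G] {f : Ξ → G} (hf : Measurable f) (i : ι) :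
    ∫ s : ι → Ξ, f (s i) ∂(Measure.pi fun _ => P) = ∫ ξ, f ξ ∂P := by
  have hmp : MeasurePreserving (Function.eval i) (Measure.pi fun _ : ι => P) P :=
    measurePreserving_eval _ i
  have := integral_map (μ := Measure.pi fun _ : ι => P) hmp.measurable.aemeasurable (f := f) hf.aestronglyMeasurable
  rw [hmp.map_eq] at this
  exact this.symm

/-- The mean of `b` independent centred vectors has `1 / b` of the second moment. -/
lemma integral_norm_average_sq {Ξ : Type*} [MeasurableSpace Ξ] {P : Measure Ξ}
    [IsProbabilityMeasure P] {p b : ℕ} {g : Ξ → E p} (hgm : Measurable g) (hg : MemLp g 2 P)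
    (h0 : ∫ ξ, g ξ ∂P = 0) :
    MemLp (fun s : Fin b → Ξ => (b : ℝ)⁻¹ • ∑ i, g (s i)) 2 (Measure.pi fun _ => P) ∧
    ∫ s : Fin b → Ξ, ‖(b : ℝ)⁻¹ • ∑ i, g (s i)‖ ^ 2 ∂(Measure.pi fun _ => P)
      = (b : ℝ)⁻¹ * ∫ ξ, ‖g ξ‖ ^ 2 ∂P := by
  have hmp : ∀ i : Fin b, MeasurePreserving (Function.eval i)
      (Measure.pi fun _ : Fin b => P) P := fun i => measurePreserving_eval _ i
  have hgi : ∀ i, MemLp (fun s : Fin b → Ξ => g (s i)) 2 (Measure.pi fun _ => P) := fun i =>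
    hg.comp_measurePreserving (hmp i)
  refine ⟨(memLp_finsetSum Finset.univ fun i _ => hgi i).const_smul ((b : ℝ)⁻¹), ?_⟩
  have hcross : ∀ i j, ∫ s : Fin b → Ξ, inner ℝ (g (s i)) (g (s j)) ∂(Measure.pi fun _ => P)
      = if i = j then ∫ ξ, ‖g ξ‖ ^ 2 ∂P else 0 := by
    intro i j
    split_ifs with hij
    · subst hij
      simp_rw [real_inner_self_eq_norm_sq]
      exact integral_eval_comp (hgm.norm.pow_const 2) i
    · have hind : IndepFun (fun s : Fin b → Ξ => g (s i)) (fun s => g (s j))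
          (Measure.pi fun _ => P) :=
        (iIndepFun_pi (X := fun _ => g) (μ := fun _ : Fin b => P)
          fun _ => hgm.aemeasurable).indepFun hij
      have h1 := hind.integral_bilin ((hgi i).integrable one_le_two)
        ((hgi j).integrable one_le_two) (innerSL ℝ)
      have h2 : ∫ s : Fin b → Ξ, g (s i) ∂(Measure.pi fun _ => P) = 0 := by
        rw [← h0]
        exact integral_eval_comp hgm i
      rw [h2, map_zero] at h1
      exact h1
  simp_rw [norm_smul, mul_pow, ← real_inner_self_eq_norm_sq (∑ _, g _), sum_inner, inner_sum]
  rw [integral_const_mul, integral_finsetSum _ fun i _ => integrable_finsetSum _ fun j _ =>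
    integrable_inner_of_memLp (hgi i) (hgi j)]
  simp_rw [integral_finsetSum Finset.univ fun j _ => integrable_inner_of_memLp (hgi _) (hgi j),
    hcross]
  simp only [Finset.sum_ite_eq, Finset.mem_univ, if_true, Finset.sum_const, Finset.card_univ,
    Fintype.card_fin, nsmul_eq_mul, norm_inv, Real.norm_natCast]
  -- For an empty batch both sides vanish, since the sum is empty and `0⁻¹ = 0`.
  rcases Nat.eq_zero_or_pos b with rfl | hb
  · simp
  · field_simp

variable {Ω α β : Type*} {mΩ : MeasurableSpace Ω} [MeasurableSpace α] [MeasurableSpace β]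
  {Pr : Measure Ω} [IsProbabilityMeasure Pr] {p : ℕ} {X : Ω → α} {S : Ω → β} {h : α → β → E p}

/-- Freezing lemma: by independence the joint law is a product, so Fubini allows a bound at each
fixed `x` to be integrated over the law of `X`. -/
lemma memLp_of_indepFun {Q : Measure β} [SFinite Q] (hX : Measurable X) (hS : Measurable S)
    (hXS : IndepFun X S Pr) (hQ : Pr.map S = Q) (hh : Measurable (Function.uncurry h))
    {v : α → ℝ} (hint : ∀ x, Integrable (fun s => ‖h x s‖ ^ 2) Q)
    (hle : ∀ x, ∫ s, ‖h x s‖ ^ 2 ∂Q ≤ v x) (hv : Integrable (fun ω => v (X ω)) Pr) :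
    MemLp (fun ω => h (X ω) (S ω)) 2 Pr ∧
      ∫ ω, ‖h (X ω) (S ω)‖ ^ 2 ∂Pr ≤ ∫ ω, v (X ω) ∂Pr := by
  have hmap : Pr.map (fun ω => (X ω, S ω)) = (Pr.map X).prod Q := by
    rw [← hQ]
    exact (indepFun_iff_map_prod_eq_prod_map_map hX.aemeasurable hS.aemeasurable).1 hXS
  have hXS' : Measurable fun ω => (X ω, S ω) := hX.prodMk hS
  have hh2 : Measurable fun q : α × β => ‖h q.1 q.2‖ ^ 2 := (hh.norm.pow_const 2)
  have hm : Measurable fun x => ∫ s, ‖h x s‖ ^ 2 ∂Q :=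
    (StronglyMeasurable.integral_prod_right hh2.stronglyMeasurable).measurable
  have hI : Integrable (fun x => ∫ s, ‖h x s‖ ^ 2 ∂Q) (Pr.map X) := by
    rw [integrable_map_measure hm.aestronglyMeasurable hX.aemeasurable]
    refine hv.mono' (hm.comp hX).aestronglyMeasurable (.of_forall fun ω => ?_)
    rw [Function.comp_apply, Real.norm_of_nonneg (integral_nonneg fun _ => by positivity)]
    exact hle _
  have hJ : Integrable (fun q : α × β => ‖h q.1 q.2‖ ^ 2) ((Pr.map X).prod Q) := by
    rw [integrable_prod_iff hh2.aestronglyMeasurable]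
    refine ⟨.of_forall fun x => hint x, ?_⟩
    simpa using hI
  constructor
  · refine (memLp_two_iff_integrable_sq_norm (hh.comp hXS').aestronglyMeasurable).2 ?_
    rw [← hmap, integrable_map_measure hh2.aestronglyMeasurable hXS'.aemeasurable] at hJ
    exact hJ
  · have e : ∫ ω, ‖h (X ω) (S ω)‖ ^ 2 ∂Pr = ∫ ω, ∫ s, ‖h (X ω) s‖ ^ 2 ∂Q ∂Pr := by
      rw [← integral_map (φ := X) hX.aemeasurable hm.aestronglyMeasurable,
        ← integral_prod _ hJ, ← hmap,
        integral_map hXS'.aemeasurable hh2.aestronglyMeasurable]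
    rw [e]
    refine integral_mono ?_ hv fun ω => hle _
    rw [integrable_map_measure hm.aestronglyMeasurable hX.aemeasurable] at hI
    exact hI

/-- Fresh noise that is centred at every frozen `x` is orthogonal to everything determined by `X`.
-/
lemma integral_inner_eq_zero_of_indepFun {Q : Measure β} [SFinite Q] (hX : Measurable X)
    (hS : Measurable S)
    (hXS : IndepFun X S Pr) (hQ : Pr.map S = Q) (hh : Measurable (Function.uncurry h))
    (hint : ∀ x, Integrable (h x) Q) (h0 : ∀ x, ∫ s, h x s ∂Q = 0)
    (hL2 : MemLp (fun ω => h (X ω) (S ω)) 2 Pr) {a : α → E p} (ha : Measurable a)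
    (haL2 : MemLp (fun ω => a (X ω)) 2 Pr) :
    ∫ ω, inner ℝ (a (X ω)) (h (X ω) (S ω)) ∂Pr = 0 := by
  have hmap : Pr.map (fun ω => (X ω, S ω)) = (Pr.map X).prod Q := by
    rw [← hQ]
    exact (indepFun_iff_map_prod_eq_prod_map_map hX.aemeasurable hS.aemeasurable).1 hXS
  have hXS' : Measurable fun ω => (X ω, S ω) := hX.prodMk hS
  have hm : Measurable fun q : α × β => (inner ℝ (a q.1) (h q.1 q.2) : ℝ) :=
    (ha.comp measurable_fst).inner hh
  have hJ : Integrable (fun q : α × β => (inner ℝ (a q.1) (h q.1 q.2) : ℝ))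
      ((Pr.map X).prod Q) := by
    rw [← hmap, integrable_map_measure hm.aestronglyMeasurable hXS'.aemeasurable]
    exact integrable_inner_of_memLp haL2 hL2
  rw [← integral_map (φ := fun ω => (X ω, S ω)) (f := fun q => inner ℝ (a q.1) (h q.1 q.2))
    hXS'.aemeasurable hm.aestronglyMeasurable, hmap, integral_prod _ hJ]
  simp [integral_inner (hint _), h0]

end Probability

/-! ### Noise of the two batches -/

section Batch

variable {p : ℕ} {Ξ : Type*} [MeasurableSpace Ξ] {P : Measure Ξ}
  {bF : E p → Ξ → E p} {F : E p → E p} {T : E p → Set (E p)} {L ρ σ : ℝ}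

lemma ExpectationSetting.miniBatch_sub [IsProbabilityMeasure P]
    (h : ExpectationSetting P bF F T L ρ σ) {b : ℕ} (hb : 0 < b) (x y : E p) :
    MemLp (fun s : Fin b → Ξ => miniBatch bF x s - miniBatch bF y s - (F x - F y)) 2
      (Measure.pi fun _ => P) ∧
    ∫ s : Fin b → Ξ, miniBatch bF x s - miniBatch bF y s - (F x - F y)
      ∂(Measure.pi fun _ => P) = 0 ∧
    ∫ s : Fin b → Ξ, ‖miniBatch bF x s - miniBatch bF y s - (F x - F y)‖ ^ 2
      ∂(Measure.pi fun _ => P) ≤ (b : ℝ)⁻¹ * increment P bF x y := by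
  set g : Ξ → E p := fun ξ => (bF x ξ - bF y ξ) - (F x - F y) with hg
  have hgm : Measurable g := ((h.measurable_bF x).sub (h.measurable_bF y)).sub_const _
  have hgd : MemLp (fun ξ => bF x ξ - bF y ξ) 2 P := (h.memLp x).sub (h.memLp y)
  have hgL : MemLp g 2 P := hgd.sub (memLp_const _)
  have hd0 : ∫ ξ, bF x ξ - bF y ξ ∂P = F x - F y := by
    rw [integral_sub (h.integrable_oracle x) (h.integrable_oracle y), h.unbiased, h.unbiased]
  have hg0 : ∫ ξ, g ξ ∂P = 0 := by
    rw [hg, integral_sub (hgd.integrable one_le_two) (integrable_const _), hd0]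
    simp
  have e : ∀ s : Fin b → Ξ, miniBatch bF x s - miniBatch bF y s - (F x - F y)
      = (b : ℝ)⁻¹ • ∑ i, g (s i) := by
    intro s
    have hb' : (b : ℝ) ≠ 0 := by positivity
    simp only [miniBatch, hg, Finset.sum_sub_distrib, Finset.sum_const, Finset.card_univ,
      Fintype.card_fin, smul_sub, ← Nat.cast_smul_eq_nsmul ℝ, smul_smul, inv_mul_cancel₀ hb',
      one_smul]
  obtain ⟨h1, h2⟩ := integral_norm_average_sq (b := b) hgm hgL hg0
  simp_rw [e]
  refine ⟨h1, ?_, ?_⟩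
  · have hmp : ∀ i : Fin b, MeasurePreserving (Function.eval i)
      (Measure.pi fun _ : Fin b => P) P := fun i => measurePreserving_eval _ i
    have hgi : ∀ i, MemLp (fun s : Fin b → Ξ => g (s i)) 2 (Measure.pi fun _ => P) := fun i =>
      hgL.comp_measurePreserving (hmp i)
    rw [integral_smul, integral_finsetSum _ fun i _ => (hgi i).integrable one_le_two]
    have : ∀ i, ∫ s : Fin b → Ξ, g (s i) ∂(Measure.pi fun _ => P) = 0 := by
      intro i
      rw [← hg0]
      exact integral_eval_comp hgm i
    simp [this]
  · rw [h2]
    gcongr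
    -- The increment equals the variance plus `‖F x - F y‖²`, so the variance is at most the
    -- increment.
    have h3 := integral_norm_add_sq hgL (memLp_const (μ := P) (F x - F y))
    have h4 : ∫ ξ, inner ℝ (g ξ) (F x - F y) ∂P = 0 := by
      simp_rw [real_inner_comm (F x - F y)]
      rw [integral_inner (hgL.integrable one_le_two), hg0, inner_zero_right]
    have h5 : ∫ ξ, ‖g ξ + (F x - F y)‖ ^ 2 ∂P = increment P bF x y := by
      simp [hg, increment]
    rw [h4, h5] at h3
    simp only [integral_const, probReal_univ, smul_eq_mul, one_mul] at h3
    nlinarith [sq_nonneg ‖F x - F y‖]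

lemma measurable_increment [SFinite P] (hm : Measurable (Function.uncurry bF)) :
    Measurable fun q : E p × E p => increment P bF q.1 q.2 := by
  refine (StronglyMeasurable.integral_prod_right
    (f := fun (q : E p × E p) ξ => ‖bF q.1 ξ - bF q.2 ξ‖ ^ 2) ?_).measurable
  refine Measurable.stronglyMeasurable ?_
  have h1 : Measurable fun q : (E p × E p) × Ξ => bF q.1.1 q.2 :=
    hm.comp ((measurable_fst.comp measurable_fst).prodMk measurable_snd)
  have h2 : Measurable fun q : (E p × E p) × Ξ => bF q.1.2 q.2 :=
    hm.comp ((measurable_snd.comp measurable_fst).prodMk measurable_snd)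
  exact (h1.sub h2).norm.pow_const 2

lemma measurable_miniBatch {b : ℕ} (hm : Measurable (Function.uncurry bF)) :
    Measurable fun q : E p × (Fin b → Ξ) => miniBatch bF q.1 q.2 := by
  refine Measurable.const_smul (g := fun q : E p × (Fin b → Ξ) => ∑ i, bF q.1 (q.2 i))
    (Finset.measurable_fun_sum Finset.univ fun i _ => ?_) ((b : ℝ)⁻¹)
  exact hm.comp (measurable_fst.prodMk ((measurable_pi_apply i).comp measurable_snd))

lemma IsBatchEstimator.measurable_comp {m : ℕ} {est : E p → (Fin m → E p) → E p}
    (he : IsBatchEstimator P bF F σ m est) (hm : Measurable (Function.uncurry bF)) :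
    Measurable fun q : E p × (Fin m → Ξ) => est q.1 fun i => bF q.1 (q.2 i) :=
  he.measurable.comp (measurable_fst.prodMk (measurable_pi_lambda _ fun i =>
    hm.comp (measurable_fst.prodMk ((measurable_pi_apply i).comp measurable_snd))))

end Batch

/-! ### The process generated by a run -/

/-- A problem instance of the class together with the samples and estimators of a run. -/
structure Experiment (p : ℕ) (Ξ Ω : Type*) [MeasurableSpace Ξ] [mΩ : MeasurableSpace Ω] where
  c : Config
  L : ℝ
  Lhat : ℝ
  ρ : ℝ
  σ : ℝ
  P : Measure Ξ
  Pr : Measure Ω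
  bF : E p → Ξ → E p
  F : E p → E p
  T : E p → Set (E p)
  x0 : E p
  xs : E p
  ℱ : Filtration ℕ mΩ
  S0 : Ω → Fin c.n0 → Ξ
  S : ℕ → Ω → Fin c.b → Ξ
  Sh : ℕ → Ω → Fin c.bh → Ξ
  est0 : (Fin c.n0 → E p) → E p
  est : ℕ → E p → (Fin c.bh → E p) → E p
  probP : IsProbabilityMeasure P
  probPr : IsProbabilityMeasure Pr
  setting : ExpectationSetting P bF F T L ρ σ
  xs_mem : xs ∈ zer (sumOp F T)
  sampling : IsSampling P Pr ℱ S0 S Sh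
  initial : IsInitialEstimator P bF F σ c.n0 x0 est0
  batch : ∀ k, 1 ≤ k → IsBatchEstimator P bF F σ c.bh (est k)
  L_pos : 0 < L
  L_lt : L < Lhat
  Lρ_lt : Lhat * ρ < 1
  lam_pos : 0 < c.lam
  lam_ge : 2 * ρ ≤ c.lam
  mu_pos : 0 < c.mu
  mu_lt : c.mu < 2 / 3
  r_ge : 5 + 1 / c.mu ≤ c.r
  beta_pos : 0 < c.beta
  beta_le : (1 + c.mu) * c.beta ≤ betaBar c.lam Lhat ρ
  b_pos : 0 < c.b

namespace Experiment

variable {p : ℕ} {Ξ Ω : Type*} [MeasurableSpace Ξ] [mΩ : MeasurableSpace Ω]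
  (X : Experiment p Ξ Ω)

attribute [instance] Experiment.probP Experiment.probPr

/-- The state at the start of iteration `k`. -/
noncomputable def q (k : ℕ) (ω : Ω) : State p :=
  run X.c X.bF X.T X.x0 X.est0 X.est (X.S0 ω) (fun j => X.S j ω) (fun j => X.Sh j ω) k

/-- The iterate `x^k`. -/
noncomputable def x (k : ℕ) (ω : Ω) : E p := (X.q k ω).x

/-- The anchor `z^k`. -/
noncomputable def z (k : ℕ) (ω : Ω) : E p := (X.q k ω).z

/-- The estimate `F̃^k`. -/
noncomputable def f (k : ℕ) (ω : Ω) : E p := (X.q (k + 1) ω).fPrev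

/-- The point `y^k`. -/
noncomputable def y (k : ℕ) (ω : Ω) : E p :=
  ((X.c.t k - 1) / X.c.t k) • X.x k ω + (1 / X.c.t k) • X.z k ω

/-- The error `F̃^k - F x^k`. -/
noncomputable def err (k : ℕ) (ω : Ω) : E p := X.f k ω - X.F (X.x k ω)

/-- The residual `G_λ`. -/
noncomputable def G (u : E p) : E p := residual X.c.lam X.F X.T u

lemma x_zero (ω : Ω) : X.x 0 ω = X.x0 := rfl

lemma z_zero (ω : Ω) : X.z 0 ω = X.x0 := rfl

lemma x_succ (k : ℕ) (ω : Ω) : X.x (k + 1) ω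
    = X.y k ω - X.c.eta k • approxResidual X.c.lam X.T (X.x k ω) (X.f k ω) := rfl

lemma z_succ (k : ℕ) (ω : Ω) :
    X.z (k + 1) ω = X.z k ω + X.c.nu • (X.x (k + 1) ω - X.y k ω) := rfl

lemma f_succ (k : ℕ) (ω : Ω) : X.f (k + 1) ω
    = (1 - X.c.tau (k + 1 : ℕ)) • (X.f k ω + miniBatch X.bF (X.x (k + 1) ω) (X.S (k + 1) ω)
        - miniBatch X.bF (X.x k ω) (X.S (k + 1) ω))
      + X.c.tau (k + 1 : ℕ) • X.est (k + 1) (X.x (k + 1) ω)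
        fun j => X.bF (X.x (k + 1) ω) (X.Sh (k + 1) ω j) := rfl

/-! #### Measurability -/

lemma measurable_approxResidual : Measurable fun u : E p × E p =>
    approxResidual X.c.lam X.T u.1 u.2 := by
  have hJ : Continuous (resolvent X.c.lam X.T) := continuous_of_norm_sub_le fun a b =>
    X.setting.cohypomonotone.norm_resolvent_sub_le X.lam_pos X.lam_ge a b
  unfold approxResidual
  exact Continuous.measurable (by fun_prop)

lemma measurable_x_update (k : ℕ) : Measurable fun u : E p × E p × E p =>
    ((X.c.t k - 1) / X.c.t k) • u.1 + (1 / X.c.t k) • u.2.1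
      - X.c.eta k • approxResidual X.c.lam X.T u.1 u.2.2 := by
  have h := X.measurable_approxResidual.comp
    (measurable_fst.prodMk (measurable_snd.comp measurable_snd) :
      Measurable fun u : E p × E p × E p => (u.1, u.2.2))
  have h1 : Measurable fun u : E p × E p × E p =>
      ((X.c.t k - 1) / X.c.t k) • u.1 + (1 / X.c.t k) • u.2.1 := by fun_prop
  exact h1.sub (h.const_smul (X.c.eta k))

lemma measurable_z_update (k : ℕ) : Measurable fun u : E p × E p × E p =>
    u.2.1 + X.c.nu • (u.2.2 - (((X.c.t k - 1) / X.c.t k) • u.1 + (1 / X.c.t k) • u.2.1)) := by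
  fun_prop

lemma measurable_f_update (k : ℕ) (hk : 1 ≤ k) (τ : ℝ) :
    Measurable fun u : (E p × E p × E p) × (Fin X.c.b → Ξ) × (Fin X.c.bh → Ξ) =>
      (1 - τ) • (u.1.2.2 + miniBatch X.bF u.1.1 u.2.1 - miniBatch X.bF u.1.2.1 u.2.1)
        + τ • X.est k u.1.1 fun j => X.bF u.1.1 (u.2.2 j) := by
  have hmb := measurable_miniBatch (b := X.c.b) X.setting.measurable_oracle
  have hes := (X.batch k hk).measurable_comp X.setting.measurable_oracle
  have h1 := hmb.comp (by fun_prop :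
    Measurable fun u : (E p × E p × E p) × (Fin X.c.b → Ξ) × (Fin X.c.bh → Ξ) =>
      (u.1.1, u.2.1))
  have h2 := hmb.comp (by fun_prop :
    Measurable fun u : (E p × E p × E p) × (Fin X.c.b → Ξ) × (Fin X.c.bh → Ξ) =>
      (u.1.2.1, u.2.1))
  have h3 := hes.comp (by fun_prop :
    Measurable fun u : (E p × E p × E p) × (Fin X.c.b → Ξ) × (Fin X.c.bh → Ξ) =>
      (u.1.1, u.2.2))
  have h4 : Measurable fun u : (E p × E p × E p) × (Fin X.c.b → Ξ) × (Fin X.c.bh → Ξ) =>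
      u.1.2.2 := by fun_prop
  exact (((h4.add h1).sub h2).const_smul (1 - τ)).add (h3.const_smul τ)

/-- The shift in the index matters: `F̃^k` uses the samples of iteration `k` and is known only at
time `k + 1`, while `x^k` and `z^k` are known at time `k`. -/
lemma measurable_adapted (k : ℕ) : Measurable[X.ℱ k] (X.x k) ∧ Measurable[X.ℱ k] (X.z k) ∧
    Measurable[X.ℱ (k + 1)] (X.f k) := by
  induction k with
  | zero =>
    refine ⟨measurable_const, measurable_const, ?_⟩
    have h : Measurable fun s : Fin X.c.n0 → Ξ => X.est0 fun i => X.bF X.x0 (s i) :=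
      X.initial.measurable.comp (measurable_pi_lambda _ fun i =>
        (X.setting.measurable_bF X.x0).comp (measurable_pi_apply i))
    exact h.comp X.sampling.adapted_init
  | succ k ih =>
    have hle : X.ℱ k ≤ X.ℱ (k + 1) := X.ℱ.mono (Nat.le_succ k)
    have hle' : X.ℱ (k + 1) ≤ X.ℱ (k + 1 + 1) := X.ℱ.mono (Nat.le_succ _)
    have hx := ih.1.mono hle le_rfl
    have hz := ih.2.1.mono hle le_rfl
    have hx' : Measurable[X.ℱ (k + 1)] (X.x (k + 1)) := by
      have h := (X.measurable_x_update k).comp (hx.prodMk (hz.prodMk ih.2.2))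
      rw [show X.x (k + 1) = _ from funext (X.x_succ k)]
      exact h
    have hz' : Measurable[X.ℱ (k + 1)] (X.z (k + 1)) := by
      have h := (X.measurable_z_update k).comp (hx.prodMk (hz.prodMk hx'))
      rw [show X.z (k + 1) = _ from funext (X.z_succ k)]
      exact h
    refine ⟨hx', hz', ?_⟩
    have hS := X.sampling.adapted (k + 1) (by omega)
    have hSh := X.sampling.adapted_hat (k + 1) (by omega)
    have hx2 := hx'.mono hle' le_rfl
    have hx1 := hx.mono hle' le_rfl
    have hf1 := ih.2.2.mono hle' le_rfl
    have hU : Measurable[X.ℱ (k + 1 + 1)]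
        fun ω => ((X.x (k + 1) ω, X.x k ω, X.f k ω), X.S (k + 1) ω, X.Sh (k + 1) ω) :=
      (hx2.prodMk (hx1.prodMk hf1)).prodMk (hS.prodMk hSh)
    have h := (X.measurable_f_update (k + 1) (by omega) (X.c.tau (k + 1 : ℕ))).comp hU
    rw [show X.f (k + 1) = _ from funext (X.f_succ k)]
    exact h

lemma measurable_x (k : ℕ) : Measurable (X.x k) :=
  (X.measurable_adapted k).1.mono (X.ℱ.le k) le_rfl

lemma measurable_f (k : ℕ) : Measurable (X.f k) :=
  (X.measurable_adapted k).2.2.mono (X.ℱ.le (k + 1)) le_rfl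

lemma measurable_F : Measurable X.F := (X.setting.continuous X.L_pos).measurable

lemma measurable_err (k : ℕ) : Measurable (X.err k) :=
  (X.measurable_f k).sub (X.measurable_F.comp (X.measurable_x k))

/-! #### Error of the estimator -/

/-- Mean-square error of the estimate `F̃^k`. -/
noncomputable def mse (k : ℕ) : ℝ := ∫ ω, ‖X.err k ω‖ ^ 2 ∂X.Pr

/-- Mean increment of the oracle between `x^k` and `x^{k+1}`. -/
noncomputable def meanIncrement (k : ℕ) : ℝ :=
  ∫ ω, increment X.P X.bF (X.x (k + 1) ω) (X.x k ω) ∂X.Pr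

lemma err_zero : MemLp (X.err 0) 2 X.Pr ∧ X.mse 0 ≤ X.σ ^ 2 / X.c.n0 := by
  have hS : Measurable X.S0 := X.sampling.adapted_init.mono (X.ℱ.le 1) le_rfl
  have hm : Measurable fun s : Fin X.c.n0 → Ξ =>
      ‖X.est0 (fun i => X.bF X.x0 (s i)) - X.F X.x0‖ ^ 2 := by
    refine ((X.initial.measurable.comp (measurable_pi_lambda _ fun i => ?_)).sub_const
      _).norm.pow_const 2
    exact (X.setting.measurable_bF X.x0).comp (measurable_pi_apply i)
  constructor
  · refine (memLp_two_iff_integrable_sq_norm (X.measurable_err 0).aestronglyMeasurable).2 ?_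
    have h := X.initial.integrable_error
    rw [← X.sampling.law_init, integrable_map_measure hm.aestronglyMeasurable hS.aemeasurable]
      at h
    exact h
  · have h := X.initial.error_le
    rw [← X.sampling.law_init, integral_map hS.aemeasurable hm.aestronglyMeasurable] at h
    exact h

lemma integrable_increment {k : ℕ} (hx : MemLp (X.x k) 2 X.Pr)
    (hx' : MemLp (X.x (k + 1)) 2 X.Pr) :
    Integrable (fun ω => increment X.P X.bF (X.x (k + 1) ω) (X.x k ω)) X.Pr := by
  refine ((integrable_norm_sq_of_memLp (hx'.sub hx)).const_mul (X.L ^ 2)).mono' ?_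
    (.of_forall fun ω => ?_)
  · exact ((measurable_increment X.setting.measurable_oracle).comp
      ((X.measurable_x (k + 1)).prodMk (X.measurable_x k))).aestronglyMeasurable
  · rw [Real.norm_of_nonneg (increment_nonneg _ _)]
    exact X.setting.increment_le X.L_pos _ _

lemma indepFun_of_adapted {α β : Type*} [MeasurableSpace α] [MeasurableSpace β] {k : ℕ}
    {u : Ω → α} {s : Ω → β} (hu : Measurable[X.ℱ k] u)
    (hs : Indep (MeasurableSpace.comap s inferInstance) (X.ℱ k) X.Pr) : IndepFun u s X.Pr := by
  rw [IndepFun_iff_Indep]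
  exact (indep_of_indep_of_le_right hs hu.comap_le).symm

/-- The new error is `(1 - τ)` times the old one plus a combination of two centred noises. Each
noise is orthogonal to the old error, so no cross term with the past survives. -/
lemma err_succ {k : ℕ} (hx : MemLp (X.x k) 2 X.Pr) (hx' : MemLp (X.x (k + 1)) 2 X.Pr)
    (he : MemLp (X.err k) 2 X.Pr) :
    MemLp (X.err (k + 1)) 2 X.Pr ∧
      X.mse (k + 1) ≤ (1 - X.c.tau (k + 1 : ℕ)) ^ 2 * (X.mse k + 2 / X.c.b * X.meanIncrement k)
        + 2 * X.c.tau (k + 1 : ℕ) ^ 2 * (X.σ ^ 2 / X.c.bh) := by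
  have hk : 1 ≤ k + 1 := by omega
  have hle : X.ℱ k ≤ X.ℱ (k + 1) := X.ℱ.mono (Nat.le_succ k)
  have hoF := X.measurable_F
  -- Everything the batches of iteration `k + 1` act on. It is known at time `k + 1`, hence
  -- independent of each batch separately.
  set U : Ω → E p × E p × E p := fun ω => (X.x (k + 1) ω, X.x k ω, X.f k ω) with hU
  have hUa : Measurable[X.ℱ (k + 1)] U :=
    (X.measurable_adapted (k + 1)).1.prodMk
      (((X.measurable_adapted k).1.mono hle le_rfl).prodMk (X.measurable_adapted k).2.2)
  have hUm : Measurable U := hUa.mono (X.ℱ.le _) le_rfl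
  have hS : Measurable (X.S (k + 1)) := (X.sampling.adapted (k + 1) hk).mono (X.ℱ.le _) le_rfl
  have hSh : Measurable (X.Sh (k + 1)) :=
    (X.sampling.adapted_hat (k + 1) hk).mono (X.ℱ.le _) le_rfl
  have hUS : IndepFun U (X.S (k + 1)) X.Pr :=
    X.indepFun_of_adapted hUa (X.sampling.indep (k + 1) hk)
  have hUSh : IndepFun U (X.Sh (k + 1)) X.Pr :=
    X.indepFun_of_adapted hUa (X.sampling.indep_hat (k + 1) hk)
  set h1 : E p × E p × E p → (Fin X.c.b → Ξ) → E p := fun u s =>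
    miniBatch X.bF u.1 s - miniBatch X.bF u.2.1 s - (X.F u.1 - X.F u.2.1) with hh1
  set h2 : E p × E p × E p → (Fin X.c.bh → Ξ) → E p := fun u s =>
    X.est (k + 1) u.1 (fun j => X.bF u.1 (s j)) - X.F u.1 with hh2
  set a : E p × E p × E p → E p := fun u => u.2.2 - X.F u.2.1 with ha
  have hmb := measurable_miniBatch (b := X.c.b) X.setting.measurable_oracle
  have hbe := X.batch (k + 1) hk
  have hm1 : Measurable (Function.uncurry h1) := by
    refine ((hmb.comp ((measurable_fst.comp measurable_fst).prodMk measurable_snd)).sub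
      (hmb.comp ((measurable_fst.comp (measurable_snd.comp measurable_fst)).prodMk
        measurable_snd))).sub ?_
    exact (hoF.comp (measurable_fst.comp measurable_fst)).sub
      (hoF.comp (measurable_fst.comp (measurable_snd.comp measurable_fst)))
  have hm2 : Measurable (Function.uncurry h2) := by
    refine ((hbe.measurable_comp X.setting.measurable_oracle).comp
      ((measurable_fst.comp measurable_fst).prodMk measurable_snd)).sub ?_
    exact hoF.comp (measurable_fst.comp measurable_fst)
  have hma : Measurable a := (measurable_snd.comp measurable_snd).sub
    (hoF.comp (measurable_fst.comp measurable_snd))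
  have hd1 := fun u : E p × E p × E p => X.setting.miniBatch_sub X.b_pos u.1 u.2.1
  obtain ⟨n1L, n1le⟩ := memLp_of_indepFun hUm hS hUS (X.sampling.law (k + 1) hk) hm1
    (v := fun u => (X.c.b : ℝ)⁻¹ * increment X.P X.bF u.1 u.2.1)
    (fun u => integrable_norm_sq_of_memLp (hd1 u).1) (fun u => (hd1 u).2.2)
    ((X.integrable_increment hx hx').const_mul _)
  obtain ⟨n2L, n2le⟩ := memLp_of_indepFun hUm hSh hUSh (X.sampling.law_hat (k + 1) hk) hm2
    (v := fun _ => X.σ ^ 2 / X.c.bh)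
    (fun u => hbe.integrable_variance u.1) (fun u => hbe.variance_le u.1) (integrable_const _)
  have c1 : ∫ ω, inner ℝ (a (U ω)) (h1 (U ω) (X.S (k + 1) ω)) ∂X.Pr = 0 :=
    integral_inner_eq_zero_of_indepFun hUm hS hUS (X.sampling.law (k + 1) hk) hm1
      (fun u => (hd1 u).1.integrable one_le_two) (fun u => (hd1 u).2.1) n1L hma he
  have c2 : ∫ ω, inner ℝ (a (U ω)) (h2 (U ω) (X.Sh (k + 1) ω)) ∂X.Pr = 0 :=
    integral_inner_eq_zero_of_indepFun hUm hSh hUSh (X.sampling.law_hat (k + 1) hk) hm2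
      (fun u => (hbe.integrable u.1).sub (integrable_const _))
      (fun u => by
        rw [integral_sub (hbe.integrable u.1) (integrable_const _), hbe.unbiased]; simp)
      n2L hma he
  set τ := X.c.tau (k + 1 : ℕ) with hτ
  set N : Ω → E p := fun ω =>
    (1 - τ) • h1 (U ω) (X.S (k + 1) ω) + τ • h2 (U ω) (X.Sh (k + 1) ω) with hN
  have hNL : MemLp N 2 X.Pr := (n1L.const_smul (1 - τ)).add (n2L.const_smul τ)
  have hAL : MemLp (fun ω => (1 - τ) • X.err k ω) 2 X.Pr := he.const_smul (1 - τ)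
  have hdec : ∀ ω, X.err (k + 1) ω = (1 - τ) • X.err k ω + N ω := by
    intro ω
    simp only [err, f_succ, hN, hh1, hh2, hU, ← hτ]
    module
  have hfun : X.err (k + 1) = (fun ω => (1 - τ) • X.err k ω) + N := funext hdec
  refine ⟨hfun ▸ hAL.add hNL, ?_⟩
  have hcross : ∫ ω, inner ℝ ((1 - τ) • X.err k ω) (N ω) ∂X.Pr = 0 := by
    have e : ∀ ω, inner ℝ ((1 - τ) • X.err k ω) (N ω)
        = (1 - τ) * (1 - τ) * inner ℝ (a (U ω)) (h1 (U ω) (X.S (k + 1) ω))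
          + (1 - τ) * τ * inner ℝ (a (U ω)) (h2 (U ω) (X.Sh (k + 1) ω)) := by
      intro ω
      change inner ℝ ((1 - τ) • a (U ω)) _ = _
      rw [hN, real_inner_smul_left, inner_add_right, real_inner_smul_right,
        real_inner_smul_right]
      ring
    have heU : MemLp (fun ω => a (U ω)) 2 X.Pr := he
    simp_rw [e]
    rw [integral_add ((integrable_inner_of_memLp heU n1L).const_mul _)
      ((integrable_inner_of_memLp heU n2L).const_mul _), integral_const_mul, integral_const_mul,
      c1, c2]
    simp
  have hNle : ∫ ω, ‖N ω‖ ^ 2 ∂X.Pr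
      ≤ 2 * (1 - τ) ^ 2 * ((X.c.b : ℝ)⁻¹ * X.meanIncrement k)
        + 2 * τ ^ 2 * (X.σ ^ 2 / X.c.bh) := by
    have i1 := integrable_norm_sq_of_memLp n1L
    have i2 := integrable_norm_sq_of_memLp n2L
    -- The two batches may be dependent, so their cross term is bounded rather than cancelled; this
    -- costs the factor 2.
    have hpt : ∀ ω, ‖N ω‖ ^ 2 ≤ 2 * (1 - τ) ^ 2 * ‖h1 (U ω) (X.S (k + 1) ω)‖ ^ 2
        + 2 * τ ^ 2 * ‖h2 (U ω) (X.Sh (k + 1) ω)‖ ^ 2 := by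
      intro ω
      have := parallelogram_law_with_norm ℝ ((1 - τ) • h1 (U ω) (X.S (k + 1) ω))
        (τ • h2 (U ω) (X.Sh (k + 1) ω))
      have e1 : ‖(1 - τ) • h1 (U ω) (X.S (k + 1) ω)‖ ^ 2
          = (1 - τ) ^ 2 * ‖h1 (U ω) (X.S (k + 1) ω)‖ ^ 2 := by
        rw [norm_smul, mul_pow, Real.norm_eq_abs, sq_abs]
      have e2 : ‖τ • h2 (U ω) (X.Sh (k + 1) ω)‖ ^ 2
          = τ ^ 2 * ‖h2 (U ω) (X.Sh (k + 1) ω)‖ ^ 2 := by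
        rw [norm_smul, mul_pow, Real.norm_eq_abs, sq_abs]
      have e3 := mul_self_nonneg ‖(1 - τ) • h1 (U ω) (X.S (k + 1) ω)
        - τ • h2 (U ω) (X.Sh (k + 1) ω)‖
      simp only [hN]
      linarith
    have i3 := (i1.const_mul (2 * (1 - τ) ^ 2)).add (i2.const_mul (2 * τ ^ 2))
    refine (integral_mono (integrable_norm_sq_of_memLp hNL) i3 hpt).trans ?_
    simp only [Pi.add_apply]
    rw [integral_add (i1.const_mul _) (i2.const_mul _), integral_const_mul, integral_const_mul]
    rw [integral_const_mul] at n1le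
    simp only [integral_const, probReal_univ, smul_eq_mul, one_mul] at n2le
    gcongr
    exact n1le
  have hA : ∫ ω, ‖(1 - τ) • X.err k ω‖ ^ 2 ∂X.Pr = (1 - τ) ^ 2 * X.mse k := by
    simp_rw [norm_smul, mul_pow, Real.norm_eq_abs, sq_abs]
    rw [integral_const_mul]
    rfl
  have hfin : X.mse (k + 1) = ∫ ω, ‖(1 - τ) • X.err k ω + N ω‖ ^ 2 ∂X.Pr := by
    simp_rw [mse, hdec]
  rw [hfin, integral_norm_add_sq hAL hNL, hcross, hA]
  have : (2 : ℝ) / X.c.b = 2 * (X.c.b : ℝ)⁻¹ := by ring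
  rw [this]
  linarith

/-! #### Square integrability -/

lemma gamma_pos : 0 < betaBar X.c.lam X.Lhat X.ρ :=
  lt_of_lt_of_le (mul_pos (by linarith [X.mu_pos]) X.beta_pos) X.beta_le

lemma cocoercive (u v : E p) :
    betaBar X.c.lam X.Lhat X.ρ * ‖X.G u - X.G v‖ ^ 2
        + (1 / X.L - 1 / X.Lhat) * increment X.P X.bF u v ≤ inner ℝ (X.G u - X.G v) (u - v) :=
  X.setting.residual_cocoercive X.L_pos X.L_lt X.Lρ_lt X.lam_pos X.lam_ge u v

lemma Lam_pos : 0 < 1 / X.L - 1 / X.Lhat :=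
  sub_pos.2 (one_div_lt_one_div_of_lt X.L_pos X.L_lt)

lemma cocoercive_xs (u : E p) :
    betaBar X.c.lam X.Lhat X.ρ * ‖X.G u‖ ^ 2 ≤ inner ℝ (X.G u) (u - X.xs) := by
  have h := X.cocoercive u X.xs
  have h0 : X.G X.xs = 0 :=
    X.setting.cohypomonotone.residual_eq_zero X.lam_pos X.lam_ge X.xs_mem
  rw [h0, sub_zero] at h
  have := mul_nonneg X.Lam_pos.le (increment_nonneg (P := X.P) (bF := X.bF) u X.xs)
  linarith

lemma norm_G_le (u : E p) : ‖X.G u‖ ≤ (betaBar X.c.lam X.Lhat X.ρ)⁻¹ * ‖u - X.xs‖ := by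
  rw [← div_eq_inv_mul, le_div_iff₀ X.gamma_pos]
  have h1 := X.cocoercive_xs u
  have h2 := real_inner_le_norm (X.G u) (u - X.xs)
  rcases (norm_nonneg (X.G u)).eq_or_lt with h0 | h0
  · rw [← h0, zero_mul]; positivity
  · refine le_of_mul_le_mul_left ?_ h0
    linarith

lemma measurable_G : Measurable X.G := by
  have h : Measurable fun u : E p => approxResidual X.c.lam X.T u (X.F u) :=
    X.measurable_approxResidual.comp (measurable_id.prodMk X.measurable_F)
  exact h

lemma memLp_G {k : ℕ} (hx : MemLp (X.x k) 2 X.Pr) :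
    MemLp (fun ω => X.G (X.x k ω)) 2 X.Pr :=
  memLp_of_norm_le_add (X.measurable_G.comp (X.measurable_x k)).aestronglyMeasurable
    (hx.sub (memLp_const X.xs)) 0 (betaBar X.c.lam X.Lhat X.ρ)⁻¹ fun ω => by
      simpa using X.norm_G_le (X.x k ω)

lemma memLp_step {k : ℕ} (hx : MemLp (X.x k) 2 X.Pr) (hz : MemLp (X.z k) 2 X.Pr)
    (he : MemLp (X.err k) 2 X.Pr) :
    MemLp (X.x (k + 1)) 2 X.Pr ∧ MemLp (X.z (k + 1)) 2 X.Pr := by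
  have hy : MemLp (X.y k) 2 X.Pr :=
    (hx.const_smul ((X.c.t k - 1) / X.c.t k)).add (hz.const_smul (1 / X.c.t k))
  have hd : MemLp (fun ω => approxResidual X.c.lam X.T (X.x k ω) (X.f k ω) - X.G (X.x k ω)) 2
      X.Pr := by
    refine memLp_of_norm_le_add ?_ he 0 1 fun ω => ?_
    · exact ((X.measurable_approxResidual.comp ((X.measurable_x k).prodMk
        (X.measurable_f k))).sub
          (X.measurable_G.comp (X.measurable_x k))).aestronglyMeasurable
    · rw [zero_add, one_mul]
      exact norm_approxResidual_sub_le X.setting.cohypomonotone X.lam_pos X.lam_ge _ _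
  have hg : MemLp (fun ω => approxResidual X.c.lam X.T (X.x k ω) (X.f k ω)) 2 X.Pr := by
    have := hd.add (X.memLp_G hx)
    refine this.congr_norm ?_ (.of_forall fun ω => by simp)
    exact (X.measurable_approxResidual.comp ((X.measurable_x k).prodMk
        (X.measurable_f k))).aestronglyMeasurable
  have hx' : MemLp (X.x (k + 1)) 2 X.Pr := hy.sub (hg.const_smul (X.c.eta k))
  exact ⟨hx', hz.add ((hx'.sub hy).const_smul X.c.nu)⟩

/-- Square integrability has to be carried jointly: the new error needs the new iterate, which needs
the old error. -/
lemma memLp (k : ℕ) :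
    MemLp (X.x k) 2 X.Pr ∧ MemLp (X.z k) 2 X.Pr ∧ MemLp (X.err k) 2 X.Pr := by
  induction k with
  | zero => exact ⟨memLp_const X.x0, memLp_const X.x0, X.err_zero.1⟩
  | succ k ih =>
    obtain ⟨hx, hz⟩ := X.memLp_step ih.1 ih.2.1 ih.2.2
    exact ⟨hx, hz, (X.err_succ ih.1 hx ih.2.2).1⟩

end Experiment

/-! ### The parameters of the scheme -/

namespace Config

variable {c : Config}

lemma t_sub_one (k : ℝ) : c.t (k - 1) = c.t k - c.mu := by
  simp only [t]; ring

/-- The range starts at `-1` because the Lyapunov function and `τ_0` involve `t_{-1}`. -/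
lemma t_ge (hmu : 0 < c.mu) (hr : 5 + 1 / c.mu ≤ c.r) {k : ℝ} (hk : -1 ≤ k) :
    1 + 4 * c.mu ≤ c.t k := by
  have h1 : c.mu * (5 + 1 / c.mu) ≤ c.mu * c.r := by gcongr
  have h2 : c.mu * (5 + 1 / c.mu) = 5 * c.mu + 1 := by field_simp
  have h3 : c.mu * (-1) ≤ c.mu * k := by gcongr
  simp only [t]
  linarith

lemma t_mono (hmu : 0 < c.mu) {k l : ℝ} (hkl : k ≤ l) : c.t k ≤ c.t l := by
  simp only [t]; gcongr

/-- The weight of the anchor term in the Lyapunov function. -/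
noncomputable def weight (c : Config) (k : ℝ) : ℝ := (1 - c.mu) / (2 * c.nu * c.eta k)

lemma eta_pos (hmu : 0 < c.mu) (hmu' : c.mu < 2 / 3) (hr : 5 + 1 / c.mu ≤ c.r)
    (hβ : 0 < c.beta) {k : ℝ} (hk : -1 ≤ k) : 0 < c.eta k := by
  have ht := t_ge hmu hr hk
  unfold eta nu
  exact div_pos (mul_pos (by positivity) (by linarith)) (by linarith)

lemma eta_le (hmu : 0 < c.mu) (hmu' : c.mu < 2 / 3) (hr : 5 + 1 / c.mu ≤ c.r)
    (hβ : 0 < c.beta) {k : ℝ} (hk : -1 ≤ k) : c.eta k ≤ 2 * c.beta := by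
  have ht := t_ge hmu hr hk
  unfold eta nu
  rw [div_le_iff₀ (by linarith)]
  gcongr
  linarith

lemma eta_mono (hmu : 0 < c.mu) (hmu' : c.mu < 2 / 3) (hr : 5 + 1 / c.mu ≤ c.r)
    (hβ : 0 < c.beta) {k l : ℝ} (hk : -1 ≤ k) (hkl : k ≤ l) : c.eta k ≤ c.eta l := by
  have ht := t_ge hmu hr hk
  have ht' := t_mono hmu hkl
  unfold eta nu
  rw [div_le_div_iff₀ (by linarith) (by linarith)]
  have h : (c.t k - 1) * (c.t l - c.mu / 2) ≤ (c.t l - 1) * (c.t k - c.mu / 2) := by nlinarith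
  have := mul_le_mul_of_nonneg_left h (by positivity : 0 ≤ 2 * c.beta)
  linarith

lemma weight_anti (hmu : 0 < c.mu) (hmu' : c.mu < 2 / 3) (hr : 5 + 1 / c.mu ≤ c.r)
    (hβ : 0 < c.beta) {k l : ℝ} (hk : -1 ≤ k) (hkl : k ≤ l) : c.weight l ≤ c.weight k := by
  have h1 := eta_pos hmu hmu' hr hβ hk
  have h2 := eta_mono hmu hmu' hr hβ hk hkl
  have h3 : 0 < c.nu := by unfold nu; positivity
  unfold weight
  gcongr
  linarith

lemma le_weight (hmu : 0 < c.mu) (hmu' : c.mu < 2 / 3) (hr : 5 + 1 / c.mu ≤ c.r)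
    (hβ : 0 < c.beta) {k : ℝ} (hk : -1 ≤ k) :
    (1 - c.mu) / (2 * c.mu * c.beta) ≤ c.weight k := by
  have h1 := eta_pos hmu hmu' hr hβ hk
  have h2 := eta_le hmu hmu' hr hβ hk
  unfold weight nu
  have e : 2 * c.mu * c.beta = 2 * (c.mu / 2) * (2 * c.beta) := by ring
  rw [e]
  gcongr
  linarith

lemma weight_mul (hmu : 0 < c.mu) (hmu' : c.mu < 2 / 3) (hr : 5 + 1 / c.mu ≤ c.r)
    (hβ : 0 < c.beta) {k : ℝ} (hk : -1 ≤ k) :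
    2 * c.nu * c.eta k * c.weight k = 1 - c.mu := by
  have h1 := eta_pos hmu hmu' hr hβ hk
  have h3 : 0 < c.nu := by unfold nu; positivity
  unfold weight
  field_simp

/-- The formula for `τ_k` is designed for the identity: multiplication by `(1 - τ_k)²` turns the
scale `t_k(t_k - 1)` into `1 - θ` times the previous scale. The last bound says that the noise
injected through `τ_k` stays bounded while `θ t_k` does. -/
lemma tau_spec (hmu : 0 < c.mu) (hr : 5 + 1 / c.mu ≤ c.r) (hθ : 0 < c.theta)
    (hθ' : c.theta ≤ 1 / 2) {k : ℝ} (hk : 0 ≤ k) :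
    c.tau k ∈ Set.Icc (0 : ℝ) 1 ∧
    (1 - c.tau k) ^ 2 * (c.t k * (c.t k - 1))
      = (1 - c.theta) * (c.t (k - 1) * (c.t (k - 1) - 1)) ∧
    c.t k * (c.t k - 1) * c.tau k ^ 2
      ≤ 2 * c.theta ^ 2 * c.t k ^ 2 + 8 * c.mu ^ 2 * (1 + 1 / (4 * c.mu)) := by
  have ht1 := t_ge hmu hr (k := k - 1) (by linarith)
  have ht := t_ge hmu hr (k := k) (by linarith)
  have hs : c.t (k - 1) = c.t k - c.mu := t_sub_one k
  set t := c.t k with htdef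
  set s := c.t (k - 1) with hsdef
  have ht0' : t ≠ 0 := by linarith
  have ht1' : t - 1 ≠ 0 := by linarith
  have hA : 0 < s * (s - 1) := mul_pos (by linarith) (by linarith)
  have hB : 0 < t * (t - 1) := mul_pos (by linarith) (by linarith)
  have hAB : s * (s - 1) ≤ t * (t - 1) := by nlinarith
  have hBA : t * (t - 1) - s * (s - 1) ≤ 2 * c.mu * t := by rw [hs]; nlinarith
  set ratio := s * (s - 1) / (t * (t - 1)) with hratio
  have hr0 : 0 ≤ ratio := by positivity
  have hr1 : ratio ≤ 1 := (div_le_one hB).2 hAB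
  have hτ : c.tau k = 1 - Real.sqrt ((1 - c.theta) * ratio) := by
    rw [tau, hratio, ← mul_div_assoc, ← mul_assoc]
  have hx0 : 0 ≤ (1 - c.theta) * ratio := mul_nonneg (by linarith) hr0
  have hx1 : (1 - c.theta) * ratio ≤ 1 := by nlinarith
  have hsq : (1 - c.tau k) ^ 2 = (1 - c.theta) * ratio := by
    rw [hτ, sub_sub_cancel, Real.sq_sqrt hx0]
  -- Since `√x ≥ x` on `[0, 1]`, `τ_k` is at most `θ` plus `1 - ratio`, and the latter is of order
  -- `1/t`.
  have hle : (1 - c.theta) * ratio ≤ Real.sqrt ((1 - c.theta) * ratio) :=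
    Real.le_sqrt_of_sq_le (by nlinarith)
  have hmem : c.tau k ∈ Set.Icc (0 : ℝ) 1 := by
    rw [hτ]
    have := Real.sqrt_le_one.2 hx1
    have := Real.sqrt_nonneg ((1 - c.theta) * ratio)
    constructor <;> linarith
  refine ⟨hmem, ?_, ?_⟩
  · rw [hsq, hratio]; field_simp
  · have h1 : c.tau k ≤ c.theta + (1 - ratio) := by
      rw [hτ]; nlinarith
    have h2 : c.tau k ^ 2 ≤ (c.theta + (1 - ratio)) ^ 2 := by
      have := hmem.1
      gcongr
    have h3 : (c.theta + (1 - ratio)) ^ 2 ≤ 2 * c.theta ^ 2 + 2 * (1 - ratio) ^ 2 := by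
      nlinarith [sq_nonneg (c.theta - (1 - ratio))]
    have h4 : t * (t - 1) * c.tau k ^ 2
        ≤ t * (t - 1) * (2 * c.theta ^ 2) + 2 * (t * (t - 1) * (1 - ratio) ^ 2) := by
      nlinarith
    have h5 : t * (t - 1) * (2 * c.theta ^ 2) ≤ 2 * c.theta ^ 2 * t ^ 2 := by
      nlinarith [sq_nonneg c.theta]
    have h6 : t * (t - 1) * (1 - ratio) ^ 2
        = (t * (t - 1) - s * (s - 1)) ^ 2 / (t * (t - 1)) := by
      rw [hratio]; field_simp
    have h7 : (t * (t - 1) - s * (s - 1)) ^ 2 / (t * (t - 1))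
        ≤ (2 * c.mu * t) ^ 2 / (t * (t - 1)) := by
      gcongr
    have h8 : (2 * c.mu * t) ^ 2 / (t * (t - 1)) ≤ 4 * c.mu ^ 2 * (1 + 1 / (4 * c.mu)) := by
      rw [div_le_iff₀ hB]
      have e : 1 + 1 / (4 * c.mu) = (4 * c.mu + 1) / (4 * c.mu) := by field_simp
      have : t ≤ (1 + 1 / (4 * c.mu)) * (t - 1) := by
        rw [e, div_mul_eq_mul_div, le_div_iff₀ (by positivity)]
        nlinarith
      have h9 : t * t ≤ t * ((1 + 1 / (4 * c.mu)) * (t - 1)) :=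
        mul_le_mul_of_nonneg_left this (by linarith)
      have h10 : 4 * c.mu ^ 2 * (t * t)
          ≤ 4 * c.mu ^ 2 * (t * ((1 + 1 / (4 * c.mu)) * (t - 1))) := by gcongr
      linarith
    linarith

lemma t_sq_le (hmu : 0 < c.mu) (hr : 5 + 1 / c.mu ≤ c.r) {k : ℝ} (hk : -1 ≤ k) :
    c.t k ^ 2 ≤ (1 + 1 / (4 * c.mu)) * (c.t k * (c.t k - 1)) := by
  have ht := t_ge hmu hr hk
  have e : 1 + 1 / (4 * c.mu) = (4 * c.mu + 1) / (4 * c.mu) := by field_simp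
  have : c.t k ≤ (1 + 1 / (4 * c.mu)) * (c.t k - 1) := by
    rw [e, div_mul_eq_mul_div, le_div_iff₀ (by positivity)]
    nlinarith
  nlinarith

end Config

/-! ### The Lyapunov function in expectation -/

namespace Experiment

variable {p : ℕ} {Ξ Ω : Type*} [MeasurableSpace Ξ] [mΩ : MeasurableSpace Ω]
  (X : Experiment p Ξ Ω)

/-- The Lyapunov function. -/
noncomputable def lyapunov (k : ℕ) (ω : Ω) : ℝ :=
  X.c.t ((k : ℝ) - 1) * (X.c.t ((k : ℝ) - 1) - 1) * X.c.beta * ‖X.G (X.x k ω)‖ ^ 2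
    + X.c.t ((k : ℝ) - 1) * inner ℝ (X.G (X.x k ω)) (X.x k ω - X.z k ω)
    + X.c.weight k * ‖X.z k ω - X.xs‖ ^ 2

noncomputable def meanLyapunov (k : ℕ) : ℝ := ∫ ω, X.lyapunov k ω ∂X.Pr

/-- Mean squared residual at `x^k`. -/
noncomputable def meanResidual (k : ℕ) : ℝ := ∫ ω, ‖X.G (X.x k ω)‖ ^ 2 ∂X.Pr

/-- Mean squared distance of the anchor `z^k` from the solution. -/
noncomputable def meanDist (k : ℕ) : ℝ := ∫ ω, ‖X.z k ω - X.xs‖ ^ 2 ∂X.Pr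

/-- The factor of the estimator error in the decrease of the Lyapunov function. -/
noncomputable def errorFactor (β γ μ : ℝ) : ℝ :=
  β ^ 2 / (γ - β) + β / (2 - 3 * μ) + 1 / 2 + 2 * β

lemma neg_one_le_natCast (k : ℕ) : (-1 : ℝ) ≤ k := by
  have : (0 : ℝ) ≤ k := k.cast_nonneg
  linarith

lemma beta_lt : X.c.beta < betaBar X.c.lam X.Lhat X.ρ := by
  nlinarith [X.beta_le, mul_pos X.mu_pos X.beta_pos]

lemma errorFactor_nonneg : 0 ≤ errorFactor X.c.beta (betaBar X.c.lam X.Lhat X.ρ) X.c.mu := by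
  have h1 := sub_pos.2 X.beta_lt
  have h2 : 0 < 2 - 3 * X.c.mu := by linarith [X.mu_lt]
  have h3 := X.beta_pos
  unfold errorFactor
  positivity

lemma lyapunov_succ_le (k : ℕ) (ω : Ω) :
    X.lyapunov (k + 1) ω + X.c.t k * (X.c.t k - 1) * ((1 / X.L - 1 / X.Lhat)
        * increment X.P X.bF (X.x (k + 1) ω) (X.x k ω))
      ≤ X.lyapunov k ω + 1 / (2 * X.c.t k ^ 2) * ‖X.z k ω - X.xs‖ ^ 2
        + errorFactor X.c.beta (betaBar X.c.lam X.Lhat X.ρ) X.c.mu * X.c.t k ^ 2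
          * ‖X.err k ω‖ ^ 2 := by
  have hk := neg_one_le_natCast k
  have ht := Config.t_ge X.mu_pos X.r_ge hk
  -- The scheme is read as an exact step with `G` perturbed by `e`; nonexpansiveness of the
  -- resolvent bounds `e` by the estimator error.
  set e := approxResidual X.c.lam X.T (X.x k ω) (X.f k ω) - X.G (X.x k ω) with he
  have hn : ‖e‖ ≤ ‖X.err k ω‖ :=
    norm_approxResidual_sub_le X.setting.cohypomonotone X.lam_pos X.lam_ge _ _
  have h := step_lyapunov_le (e := e) (w := X.c.weight k) (w' := X.c.weight (k + 1 : ℕ))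
    (η := X.c.eta k) (ν := X.c.nu) (xs := X.xs)
    rfl X.mu_pos X.mu_lt X.beta_pos X.beta_le
    (by linarith [X.mu_pos]) rfl
    (Config.weight_mul X.mu_pos X.mu_lt X.r_ge X.beta_pos hk)
    (Config.weight_anti X.mu_pos X.mu_lt X.r_ge X.beta_pos hk (by push_cast; linarith))
    (show X.y k ω = _ from rfl)
    (by rw [he, add_sub_cancel]; exact X.x_succ k ω) (X.z_succ k ω)
    (X.cocoercive (X.x (k + 1) ω) (X.x k ω)) (X.cocoercive_xs (X.x k ω))
  have h2 : errorFactor X.c.beta (betaBar X.c.lam X.Lhat X.ρ) X.c.mu * X.c.t k ^ 2 * ‖e‖ ^ 2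
      ≤ errorFactor X.c.beta (betaBar X.c.lam X.Lhat X.ρ) X.c.mu * X.c.t k ^ 2
        * ‖X.err k ω‖ ^ 2 := by
    have := X.errorFactor_nonneg
    gcongr
  unfold lyapunov
  rw [show ((k + 1 : ℕ) : ℝ) - 1 = k by push_cast; ring, Config.t_sub_one]
  unfold errorFactor at h2 ⊢
  linarith

lemma lyapunov_ge' {a : ℝ} (ha : 0 < a) (k : ℕ) (ω : Ω) :
    (X.c.beta - a) * X.c.t ((k : ℝ) - 1) ^ 2 * ‖X.G (X.x k ω)‖ ^ 2
        + ((1 - X.c.mu) / (2 * X.c.mu * X.c.beta) - 1 / (4 * a)) * ‖X.z k ω - X.xs‖ ^ 2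
      ≤ X.lyapunov k ω := by
  have hk := neg_one_le_natCast k
  have hk' : (-1 : ℝ) ≤ (k : ℝ) - 1 := by linarith [(k.cast_nonneg : (0 : ℝ) ≤ k)]
  have ht := Config.t_ge X.mu_pos X.r_ge hk'
  have h := lyapunov_ge (w := X.c.weight k) (z := X.z k ω) X.beta_lt.le
    (by linarith [X.mu_pos] : 0 ≤ X.c.t ((k : ℝ) - 1)) ha (X.cocoercive_xs (X.x k ω))
  have hw := Config.le_weight X.mu_pos X.mu_lt X.r_ge X.beta_pos hk
  refine le_trans ?_ h
  gcongr

lemma integrable_residual (k : ℕ) : Integrable (fun ω => ‖X.G (X.x k ω)‖ ^ 2) X.Pr :=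
  integrable_norm_sq_of_memLp (X.memLp_G (X.memLp k).1)

lemma integrable_dist (k : ℕ) : Integrable (fun ω => ‖X.z k ω - X.xs‖ ^ 2) X.Pr :=
  integrable_norm_sq_of_memLp ((X.memLp k).2.1.sub (memLp_const _))

lemma integrable_lyapunov (k : ℕ) : Integrable (X.lyapunov k) X.Pr :=
  (((X.integrable_residual k).const_mul _).add
    ((integrable_inner_of_memLp (X.memLp_G (X.memLp k).1)
      ((X.memLp k).1.sub (X.memLp k).2.1)).const_mul _)).add ((X.integrable_dist k).const_mul _)

lemma meanLyapunov_succ_le (k : ℕ) :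
    X.meanLyapunov (k + 1) + X.c.t k * (X.c.t k - 1) * ((1 / X.L - 1 / X.Lhat)
        * X.meanIncrement k)
      ≤ X.meanLyapunov k + 1 / (2 * X.c.t k ^ 2) * X.meanDist k
        + errorFactor X.c.beta (betaBar X.c.lam X.Lhat X.ρ) X.c.mu * X.c.t k ^ 2 * X.mse k := by
  have i1 := X.integrable_lyapunov (k + 1)
  have i2 := (((X.integrable_increment (X.memLp k).1 (X.memLp (k + 1)).1).const_mul
    (1 / X.L - 1 / X.Lhat))).const_mul (X.c.t k * (X.c.t k - 1))
  have i3 := (X.integrable_dist k).const_mul (1 / (2 * X.c.t k ^ 2))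
  have i4 := (integrable_norm_sq_of_memLp (X.memLp k).2.2).const_mul
    (errorFactor X.c.beta (betaBar X.c.lam X.Lhat X.ρ) X.c.mu * X.c.t k ^ 2)
  have h := integral_mono (i1.add i2) (((X.integrable_lyapunov k).add i3).add i4)
    fun ω => X.lyapunov_succ_le k ω
  simp only [Pi.add_apply] at h
  rw [integral_add i1 i2, integral_add (by exact (X.integrable_lyapunov k).add i3) i4,
    integral_add (X.integrable_lyapunov k) i3] at h
  simp only [integral_const_mul] at h
  exact h

lemma le_meanLyapunov {a : ℝ} (ha : 0 < a) (k : ℕ) :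
    (X.c.beta - a) * X.c.t ((k : ℝ) - 1) ^ 2 * X.meanResidual k
        + ((1 - X.c.mu) / (2 * X.c.mu * X.c.beta) - 1 / (4 * a)) * X.meanDist k
      ≤ X.meanLyapunov k := by
  have i1 := (X.integrable_residual k).const_mul ((X.c.beta - a) * X.c.t ((k : ℝ) - 1) ^ 2)
  have i2 := (X.integrable_dist k).const_mul
    ((1 - X.c.mu) / (2 * X.c.mu * X.c.beta) - 1 / (4 * a))
  have h := integral_mono (i1.add i2) (X.integrable_lyapunov k) fun ω => X.lyapunov_ge' ha k ω
  simp only [Pi.add_apply] at h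
  rw [integral_add i1 i2] at h
  simp only [integral_const_mul] at h
  exact h

lemma meanLyapunov_zero_le {R : ℝ} (hR : ‖X.x0 - X.xs‖ ≤ R) : X.meanLyapunov 0
    ≤ (X.c.t (-1) * (X.c.t (-1) - 1) * X.c.beta * (betaBar X.c.lam X.Lhat X.ρ)⁻¹ ^ 2
      + X.c.weight 0) * R ^ 2 := by
  have ht := Config.t_ge X.mu_pos X.r_ge (le_refl (-1))
  have hw := Config.le_weight X.mu_pos X.mu_lt X.r_ge X.beta_pos (k := 0) (by norm_num)
  have hβ := X.beta_pos
  have hmu := X.mu_pos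
  have hw0 : 0 ≤ X.c.weight 0 :=
    le_trans (div_nonneg (by linarith [X.mu_lt]) (by positivity)) hw
  have hG := X.norm_G_le X.x0
  have hγ := X.gamma_pos
  have e : ∀ ω, X.lyapunov 0 ω = X.c.t (-1) * (X.c.t (-1) - 1) * X.c.beta * ‖X.G X.x0‖ ^ 2
      + X.c.weight 0 * ‖X.x0 - X.xs‖ ^ 2 := by
    intro ω
    simp [lyapunov, x_zero, z_zero]
  simp only [meanLyapunov, e, integral_const, probReal_univ, smul_eq_mul, one_mul]
  have h1 : ‖X.G X.x0‖ ^ 2 ≤ (betaBar X.c.lam X.Lhat X.ρ)⁻¹ ^ 2 * R ^ 2 := by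
    rw [← mul_pow]
    gcongr
    exact hG.trans (by gcongr)
  have h2 : ‖X.x0 - X.xs‖ ^ 2 ≤ R ^ 2 := by gcongr
  have h3 : 0 ≤ X.c.t (-1) * (X.c.t (-1) - 1) * X.c.beta :=
    mul_nonneg (mul_nonneg (by linarith) (by linarith)) hβ.le
  have h4 := mul_le_mul_of_nonneg_left h1 h3
  have h5 := mul_le_mul_of_nonneg_left h2 hw0
  linarith

/-! #### Numbers of calls -/

lemma resolventCalls_eq (k : ℕ) (ω : Ω) : (X.q k ω).resolventCalls = k := by
  induction k with
  | zero => rfl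
  | succ k ih =>
    change (X.q k ω).resolventCalls + 1 = k + 1
    rw [ih]

lemma oracleCalls_succ (k : ℕ) (ω : Ω) :
    (X.q (k + 1) ω).oracleCalls = X.c.n0 + k * (2 * X.c.b + X.c.bh) := by
  induction k with
  | zero => simp [q, run, step]
  | succ k ih =>
    change (X.q (k + 1) ω).oracleCalls + (if k + 1 = 0 then X.c.n0 else 2 * X.c.b + X.c.bh) = _
    rw [ih, if_neg (by omega)]
    ring

end Experiment

/-! ### The scalar recursion -/

/-- The factor `exp (A / (k + r - 1))` is a telescoping integrating factor, so the product of the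
growth factors is bounded uniformly in `K`. -/
lemma le_exp_mul_of_recursion {A r n : ℝ} {W : ℕ → ℝ} {K : ℕ} (hA : 0 ≤ A) (hr : 2 ≤ r)
    (hn : 0 ≤ n) (hW : ∀ k, 0 ≤ W k)
    (h : ∀ k < K, W (k + 1) ≤ (1 + A / (k + r) ^ 2) * W k + n) :
    W K ≤ Real.exp A * (W 0 + K * n) := by
  have key : ∀ k ≤ K, W k * Real.exp (A / (k + r - 1)) ≤ Real.exp A * (W 0 + k * n) := by
    intro k
    induction k with
    | zero =>
      intro _
      have : A / ((0 : ℕ) + r - 1) ≤ A := div_le_self hA (by push_cast; linarith)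
      have h1 := mul_le_mul_of_nonneg_left (Real.exp_le_exp.2 this) (hW 0)
      simp only [Nat.cast_zero, zero_mul, add_zero] at h1 ⊢
      linarith
    | succ k ih =>
      intro hk
      have h0 := ih (by omega)
      have h1 := h k (by omega)
      have hk0 : (0 : ℝ) ≤ k := k.cast_nonneg
      have hkr : 0 < (k : ℝ) + r - 1 := by linarith
      have hkr' : 0 < (k : ℝ) + r := by linarith
      have e : ((k + 1 : ℕ) : ℝ) + r - 1 = k + r := by push_cast; ring
      rw [e]
      have h2 : (1 + A / (k + r) ^ 2) * Real.exp (A / (k + r))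
          ≤ Real.exp (A / (k + r - 1)) := by
        have h3 : 1 + A / (k + r) ^ 2 ≤ Real.exp (A / (k + r) ^ 2) := by
          linarith [Real.add_one_le_exp (A / (k + r) ^ 2)]
        calc (1 + A / (k + r) ^ 2) * Real.exp (A / (k + r))
            ≤ Real.exp (A / (k + r) ^ 2) * Real.exp (A / (k + r)) := by gcongr
          _ = Real.exp (A / (k + r) ^ 2 + A / (k + r)) := (Real.exp_add _ _).symm
          _ ≤ Real.exp (A / (k + r - 1)) := by
            apply Real.exp_le_exp.2
            -- The telescoping inequality `1/m² ≤ 1/(m-1) - 1/m`.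
            have : 1 / ((k : ℝ) + r) ^ 2 + 1 / (k + r) ≤ 1 / (k + r - 1) := by
              rw [div_add_div _ _ (by positivity) (by positivity),
                div_le_div_iff₀ (by positivity) hkr]
              nlinarith
            calc A / ((k : ℝ) + r) ^ 2 + A / (k + r)
                = A * (1 / ((k : ℝ) + r) ^ 2 + 1 / (k + r)) := by ring
              _ ≤ A * (1 / (k + r - 1)) := by gcongr
              _ = A / (k + r - 1) := by ring
      have h4 : Real.exp (A / (k + r)) ≤ Real.exp A :=
        Real.exp_le_exp.2 (div_le_self hA (by linarith))
      calc W (k + 1) * Real.exp (A / (k + r))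
          ≤ ((1 + A / (k + r) ^ 2) * W k + n) * Real.exp (A / (k + r)) := by gcongr
        _ = W k * ((1 + A / (k + r) ^ 2) * Real.exp (A / (k + r)))
            + n * Real.exp (A / (k + r)) := by ring
        _ ≤ W k * Real.exp (A / (k + r - 1)) + n * Real.exp A := by
          have := hW k
          gcongr
        _ ≤ Real.exp A * (W 0 + (k + 1 : ℕ) * n) := by push_cast; linarith
  refine le_trans ?_ (key K le_rfl)
  have : 1 ≤ Real.exp (A / (K + r - 1)) := by
    apply Real.one_le_exp
    have : (0 : ℝ) ≤ K := K.cast_nonneg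
    exact div_nonneg hA (by linarith)
  exact le_mul_of_one_le_right (hW K) this

/-- Coupled recursion of a Lyapunov sequence `v`, scaled errors `Q` and scaled increments `I`. -/
lemma coupled_recursion_le {A r n ε B Λ b : ℝ} {v Q I : ℕ → ℝ} {K : ℕ} (hA : 0 ≤ A)
    (hr : 2 ≤ r) (hn : 0 ≤ n) (hε : 0 < ε) (hB : 0 ≤ B) (hb : 0 < b)
    (hbε : 2 * B ≤ Λ * (ε * b)) (hv : ∀ k, 0 ≤ v k) (hQ : ∀ k, 0 ≤ Q k) (hI : ∀ k, 0 ≤ I k)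
    (h1 : ∀ k, v (k + 1) + Λ * I k ≤ (1 + A / (k + r) ^ 2) * v k + B * Q k)
    (h2 : ∀ k < K, Q (k + 1) ≤ (1 - ε) * (Q k + 2 / b * I k) + n) :
    v K ≤ Real.exp A * (v 0 + B / ε * Q 0 + K * (B / ε * n)) := by
  have hBε : 0 ≤ B / ε := by positivity
  -- With the weight `B / ε` on `Q`, the loss `ε Q` cancels `B Q` exactly, and `hbε` lets `Λ I`
  -- absorb the increments.
  have h := le_exp_mul_of_recursion (W := fun k => v k + B / ε * Q k) (n := B / ε * n) (K := K)
    hA hr (by positivity) (fun k => add_nonneg (hv k) (mul_nonneg hBε (hQ k))) (by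
      intro k hk
      have g1 := h1 k
      have g2 := mul_le_mul_of_nonneg_left (h2 k hk) hBε
      have g3 : B / ε * (2 / b) ≤ Λ := by
        rw [div_mul_div_comm, div_le_iff₀ (by positivity)]
        linarith
      have g4 : B / ε * (2 / b) * I k ≤ Λ * I k := mul_le_mul_of_nonneg_right g3 (hI k)
      have g5 : 0 ≤ B / ε * (ε * (2 / b * I k)) :=
        mul_nonneg hBε (mul_nonneg hε.le (mul_nonneg (by positivity) (hI k)))
      have g6 : B / ε * (ε * Q k) = B * Q k := by field_simp
      have g7 : 0 ≤ A / (k + r) ^ 2 * (B / ε * Q k) :=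
        mul_nonneg (by positivity) (mul_nonneg hBε (hQ k))
      linarith)
  have h0 : v K ≤ v K + B / ε * Q K := le_add_of_nonneg_right (mul_nonneg hBε (hQ K))
  exact h0.trans h

/-! ### Application of the scalar recursion to the expectations along a run. -/

namespace Experiment

variable {p : ℕ} {Ξ Ω : Type*} [MeasurableSpace Ξ] [mΩ : MeasurableSpace Ω]
  (X : Experiment p Ξ Ω)

lemma meanDist_nonneg (k : ℕ) : 0 ≤ X.meanDist k := integral_nonneg fun _ => by positivity

lemma meanResidual_nonneg (k : ℕ) : 0 ≤ X.meanResidual k :=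
  integral_nonneg fun _ => by positivity

lemma mse_nonneg (k : ℕ) : 0 ≤ X.mse k := integral_nonneg fun _ => by positivity

lemma meanIncrement_nonneg (k : ℕ) : 0 ≤ X.meanIncrement k :=
  integral_nonneg fun _ => increment_nonneg _ _

/-- Bound of the Lyapunov function at iteration `K`, when `θ (K + r) ≤ H`. -/
lemma meanLyapunov_le {a B H R : ℝ} (hθ : 0 < X.c.theta) (hθ' : X.c.theta ≤ 1 / 2)
    (ha : 0 < a) (haβ : a < X.c.beta)
    (ha' : 1 / (4 * a) < (1 - X.c.mu) / (2 * X.c.mu * X.c.beta))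
    (hB : B = errorFactor X.c.beta (betaBar X.c.lam X.Lhat X.ρ) X.c.mu
      * (1 + 1 / (4 * X.c.mu)))
    (hb : 2 * B ≤ (1 / X.L - 1 / X.Lhat) * (X.c.theta * X.c.b)) {K : ℕ}
    (hK : X.c.theta * (K + X.c.r) ≤ H) (hR : ‖X.x0 - X.xs‖ ≤ R) :
    X.meanLyapunov K
      ≤ Real.exp (1 / (2 * ((1 - X.c.mu) / (2 * X.c.mu * X.c.beta) - 1 / (4 * a))
          * X.c.mu ^ 2))
        * ((X.c.t (-1) * (X.c.t (-1) - 1) * X.c.beta * (betaBar X.c.lam X.Lhat X.ρ)⁻¹ ^ 2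
            + X.c.weight 0) * R ^ 2
          + B / X.c.theta * (X.c.t 0 * (X.c.t 0 - 1) * (X.σ ^ 2 / X.c.n0))
          + K * (B / X.c.theta * ((2 * X.c.mu ^ 2 * H ^ 2
            + 8 * X.c.mu ^ 2 * (1 + 1 / (4 * X.c.mu))) * (2 * (X.σ ^ 2 / X.c.bh))))) := by
  have hmu := X.mu_pos
  have hr5 : 5 ≤ X.c.r := by
    have : 0 < 1 / X.c.mu := by positivity
    linarith [X.r_ge]
  set c2 := (1 - X.c.mu) / (2 * X.c.mu * X.c.beta) - 1 / (4 * a) with hc2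
  have hc20 : 0 < c2 := sub_pos.2 ha'
  have ht : ∀ k : ℕ, 1 + 4 * X.c.mu ≤ X.c.t k := fun k =>
    Config.t_ge X.mu_pos X.r_ge (neg_one_le_natCast k)
  have hq : ∀ k : ℕ, 0 ≤ X.c.t k * (X.c.t k - 1) := fun k =>
    mul_nonneg (by linarith [ht k]) (by linarith [ht k])
  have hE := X.errorFactor_nonneg
  have hB0 : 0 ≤ B := by rw [hB]; positivity
  have hge : ∀ k, c2 * X.meanDist k ≤ X.meanLyapunov k := by
    intro k
    have h := X.le_meanLyapunov ha k
    have h' : 0 ≤ (X.c.beta - a) * X.c.t ((k : ℝ) - 1) ^ 2 * X.meanResidual k :=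
      mul_nonneg (mul_nonneg (by linarith) (by positivity)) (X.meanResidual_nonneg k)
    linarith
  have hv : ∀ k, 0 ≤ X.meanLyapunov k := fun k =>
    (mul_nonneg hc20.le (X.meanDist_nonneg k)).trans (hge k)
  have hmain := coupled_recursion_le (A := 1 / (2 * c2 * X.c.mu ^ 2)) (r := X.c.r)
    (n := (2 * X.c.mu ^ 2 * H ^ 2 + 8 * X.c.mu ^ 2 * (1 + 1 / (4 * X.c.mu)))
      * (2 * (X.σ ^ 2 / X.c.bh))) (K := K)
    (v := X.meanLyapunov) (Q := fun k => X.c.t k * (X.c.t k - 1) * X.mse k)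
    (I := fun k => X.c.t k * (X.c.t k - 1) * X.meanIncrement k)
    (by positivity) (by linarith) (by positivity) hθ hB0 (by exact_mod_cast X.b_pos) hb hv
    (fun k => mul_nonneg (hq k) (X.mse_nonneg k))
    (fun k => mul_nonneg (hq k) (X.meanIncrement_nonneg k))
    (by
      intro k
      have h := X.meanLyapunov_succ_le k
      have htk : X.c.t k = X.c.mu * (k + X.c.r) := rfl
      have hkr : 0 < (k : ℝ) + X.c.r := by linarith [(k.cast_nonneg : (0 : ℝ) ≤ k)]
      -- Coercivity turns the anchor distance into a multiple of the Lyapunov function; this is the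
      -- origin of `A`.
      have h1 : 1 / (2 * X.c.t k ^ 2) * X.meanDist k
          ≤ 1 / (2 * c2 * X.c.mu ^ 2) / (k + X.c.r) ^ 2 * X.meanLyapunov k := by
        have e : 1 / (2 * X.c.t k ^ 2) * X.meanDist k
            = 1 / (2 * c2 * X.c.mu ^ 2) / (k + X.c.r) ^ 2 * (c2 * X.meanDist k) := by
          rw [htk]; field_simp
        rw [e]
        have := hge k
        gcongr
      have h2 := mul_le_mul_of_nonneg_right
        (Config.t_sq_le X.mu_pos X.r_ge (neg_one_le_natCast k))
        (mul_nonneg hE (X.mse_nonneg k))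
      rw [hB]
      linarith)
    (by
      intro k hk
      have hk0 : (0 : ℝ) ≤ k := k.cast_nonneg
      have h := (X.err_succ (X.memLp k).1 (X.memLp (k + 1)).1 (X.memLp k).2.2).2
      obtain ⟨-, h1, h2⟩ := Config.tau_spec X.mu_pos X.r_ge hθ hθ' (k := ((k + 1 : ℕ) : ℝ))
        (by positivity)
      rw [show ((k + 1 : ℕ) : ℝ) - 1 = k by push_cast; ring] at h1
      have h3 := mul_le_mul_of_nonneg_left h (hq (k + 1))
      -- The finite horizon enters here: `θ t_k ≤ μ H` up to iteration `K` keeps the injected noise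
      -- bounded uniformly in `ε`.
      have h4 : X.c.theta ^ 2 * X.c.t (k + 1 : ℕ) ^ 2 ≤ X.c.mu ^ 2 * H ^ 2 := by
        have h5 : X.c.theta * X.c.t (k + 1 : ℕ) ≤ X.c.mu * H := by
          have : ((k + 1 : ℕ) : ℝ) ≤ K := by exact_mod_cast hk
          calc X.c.theta * X.c.t (k + 1 : ℕ)
              = X.c.mu * (X.c.theta * ((k + 1 : ℕ) + X.c.r)) := by
                simp only [Config.t]; ring
            _ ≤ X.c.mu * (X.c.theta * (K + X.c.r)) := by gcongr
            _ ≤ X.c.mu * H := by gcongr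
        have h6 : 0 ≤ X.c.theta * X.c.t (k + 1 : ℕ) :=
          mul_nonneg hθ.le (by linarith [ht (k + 1)])
        rw [← mul_pow, ← mul_pow]
        gcongr
      have h7 : 0 ≤ 2 * (X.σ ^ 2 / X.c.bh) := by positivity
      have h8 := mul_le_mul_of_nonneg_right (h2.trans (by linarith :
        2 * X.c.theta ^ 2 * X.c.t (k + 1 : ℕ) ^ 2
          + 8 * X.c.mu ^ 2 * (1 + 1 / (4 * X.c.mu))
        ≤ 2 * X.c.mu ^ 2 * H ^ 2 + 8 * X.c.mu ^ 2 * (1 + 1 / (4 * X.c.mu)))) h7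
      have h9 : X.c.t (k + 1 : ℕ) * (X.c.t (k + 1 : ℕ) - 1)
          * ((1 - X.c.tau (k + 1 : ℕ)) ^ 2 * (X.mse k + 2 / X.c.b * X.meanIncrement k))
          = (1 - X.c.theta) * (X.c.t k * (X.c.t k - 1) * X.mse k
            + 2 / X.c.b * (X.c.t k * (X.c.t k - 1) * X.meanIncrement k)) := by
        calc _ = (1 - X.c.tau (k + 1 : ℕ)) ^ 2
              * (X.c.t (k + 1 : ℕ) * (X.c.t (k + 1 : ℕ) - 1))
              * (X.mse k + 2 / X.c.b * X.meanIncrement k) := by ring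
          _ = _ := by rw [h1]; ring
      linarith)
  refine hmain.trans ?_
  have h0 := X.meanLyapunov_zero_le hR
  have h1 : B / X.c.theta * (X.c.t (0 : ℕ) * (X.c.t (0 : ℕ) - 1) * X.mse 0)
      ≤ B / X.c.theta * (X.c.t 0 * (X.c.t 0 - 1) * (X.σ ^ 2 / X.c.n0)) := by
    have h2 := X.err_zero.2
    have h3 := hq 0
    rw [Nat.cast_zero] at h3 ⊢
    gcongr
  gcongr

end Experiment

/-! ### Choice of the constants -/

lemma half_le_natFloor {a : ℝ} (ha : 1 ≤ a) : 1 ≤ ⌊a⌋₊ ∧ a / 2 ≤ ⌊a⌋₊ := by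
  have h1 : 1 ≤ ⌊a⌋₊ := Nat.le_floor (by exact_mod_cast ha)
  have h2 := Nat.lt_floor_add_one a
  have h3 : (1 : ℝ) ≤ ⌊a⌋₊ := by exact_mod_cast h1
  exact ⟨h1, by linarith⟩

/-- The base configuration, without tolerance and batch sizes. -/
noncomputable def baseConfig (lam mu r beta : ℝ) : Config := ⟨lam, mu, r, beta, 0, 0, 0, 0⟩

/-- A number `a < β` for which the Lyapunov function with weight `w` is coercive. -/
lemma exists_coercivity_parameter {β w : ℝ} (hβ : 0 < β) (hw : 1 / (4 * β) < w) :
    ∃ a, 0 < a ∧ a < β ∧ 1 / (4 * a) < w := by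
  have h0 : 0 < 1 / (4 * β) := by positivity
  obtain ⟨m, hm1, hm2⟩ := exists_between hw
  have hm0 : 0 < m := h0.trans hm1
  refine ⟨1 / (4 * m), by positivity, ?_, ?_⟩
  · rw [div_lt_iff₀ (by positivity)] at hm1 ⊢
    linarith
  · have : 1 / (4 * (1 / (4 * m))) = m := by field_simp
    rwa [this]

/-- Equivalent to `μ < 2/3`; it leaves room for an `a < β` for which both lower-bound coefficients
are positive. -/
lemma anchor_weight_gt {β μ : ℝ} (hβ : 0 < β) (hμ : 0 < μ) (hμ' : μ < 2 / 3) :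
    1 / (4 * β) < (1 - μ) / (2 * μ * β) := by
  rw [div_lt_div_iff₀ (by positivity) (by positivity)]
  nlinarith [mul_pos hβ hμ]

/-- Because `(2 - μ)(1 + μ) = 2 + μ - μ² ≤ 2 + μ`. -/
lemma one_add_mul_le_betaBar {β μ γ : ℝ} (hβ : 0 < β) (hμ : 0 < μ) (hμ' : μ < 2 / 3)
    (h : β ≤ (2 - μ) * γ / (2 + μ)) : (1 + μ) * β ≤ γ := by
  rw [le_div_iff₀ (by linarith)] at h
  have h1 : (2 - μ) * ((1 + μ) * β) ≤ (2 - μ) * γ := by nlinarith [mul_pos hβ hμ]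
  exact le_of_mul_le_mul_left h1 (by linarith)

/-- The noise of the batches `Ŝ_k` accumulated over `K ≤ (κ + 1) / ε` iterations is bounded. -/
lemma accumulated_noise_le {κ B N σ cbh ε : ℝ} {K bh : ℕ} (hκ : 0 ≤ κ) (hB : 0 ≤ B)
    (hN : 0 ≤ N) (hε : 0 < ε) (hcbh : 4 * (κ + 1) * B * N * σ ^ 2 ≤ cbh) (hcbh0 : 0 < cbh)
    (hbh : cbh / ε ^ 2 / 2 ≤ bh) (hK : K ≤ (κ + 1) / ε) :
    K * (B / ε * (N * (2 * (σ ^ 2 / bh)))) ≤ 1 := by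
  have h1 : σ ^ 2 / bh ≤ σ ^ 2 / (cbh / ε ^ 2 / 2) := by gcongr
  calc K * (B / ε * (N * (2 * (σ ^ 2 / bh))))
      ≤ (κ + 1) / ε * (B / ε * (N * (2 * (σ ^ 2 / (cbh / ε ^ 2 / 2))))) := by gcongr
    _ = 4 * (κ + 1) * B * N * σ ^ 2 / cbh := by field_simp; ring
    _ ≤ 1 := (div_le_one hcbh0).2 hcbh

/-- The work of `K ≤ (κ + 1) / ε` iterations. -/
lemma total_calls_le {κ cb cbh ε : ℝ} {K n0 b bh : ℕ} (hκ : 0 ≤ κ) (hε : 0 < ε) (hε1 : ε ≤ 1)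
    (hcb : 0 < cb)
    (hn0 : n0 ≤ 1 / ε) (hb : b ≤ cb / ε) (hbh : bh ≤ cbh / ε ^ 2) (hK : K ≤ (κ + 1) / ε) :
    (n0 : ℝ) + K * (2 * b + bh) + K ≤ (1 + (κ + 1) * (2 * cb + cbh + 1)) / ε ^ 3 := by
  have hε31 : ε ^ 3 ≤ ε := pow_le_of_le_one hε.le hε1 (by norm_num)
  have hε32 : ε ^ 3 ≤ ε ^ 2 := pow_le_pow_of_le_one hε.le hε1 (by norm_num)
  have e1 : 1 / ε ≤ 1 / ε ^ 3 := by
    gcongr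
  have e2 : (K : ℝ) * (2 * b) ≤ (κ + 1) * (2 * cb) / ε ^ 3 := by
    calc (K : ℝ) * (2 * b) ≤ (κ + 1) / ε * (2 * (cb / ε)) := by gcongr
      _ = (κ + 1) * (2 * cb) / ε ^ 2 := by field_simp
      _ ≤ (κ + 1) * (2 * cb) / ε ^ 3 := by
        gcongr
  have e3 : (K : ℝ) * bh ≤ (κ + 1) * cbh / ε ^ 3 := by
    calc (K : ℝ) * bh ≤ (κ + 1) / ε * (cbh / ε ^ 2) := by gcongr
      _ = (κ + 1) * cbh / ε ^ 3 := by field_simp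
  have e4 : (K : ℝ) ≤ (κ + 1) / ε ^ 3 := by
    refine hK.trans ?_
    gcongr
  have e5 : (1 + (κ + 1) * (2 * cb + cbh + 1)) / ε ^ 3 = 1 / ε ^ 3
      + (κ + 1) * (2 * cb) / ε ^ 3 + (κ + 1) * cbh / ε ^ 3 + (κ + 1) / ε ^ 3 := by ring
  rw [e5]
  linarith

/-- Final residual bound for an experiment whose parameters satisfy the stated inequalities. -/
lemma Experiment.meanResidual_le {p : ℕ} {Ξ Ω : Type*} [MeasurableSpace Ξ]
    [mΩ : MeasurableSpace Ω] (X : Experiment p Ξ Ω) {a M κ ε : ℝ} {K : ℕ}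
    (hε : 0 < ε) (hκ : 1 ≤ κ) (ha : 0 < a) (haβ : a < X.c.beta)
    (ha' : 1 / (4 * a) < (1 - X.c.mu) / (2 * X.c.mu * X.c.beta))
    (hM : M / ((X.c.beta - a) * X.c.mu ^ 2) ≤ κ)
    (hK : κ / ε ≤ K) (hv : X.meanLyapunov K ≤ M) : X.meanResidual K ≤ ε ^ 2 := by
  have hmu := X.mu_pos
  have hc1 : 0 < X.c.beta - a := by linarith
  have h := X.le_meanLyapunov ha K
  have h1 := mul_nonneg (sub_pos.2 ha').le (X.meanDist_nonneg K)
  have hr : 1 ≤ X.c.r := by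
    have : 0 < 1 / X.c.mu := by positivity
    linarith [X.r_ge]
  -- The Lyapunov function at `K` carries `t_{K-1}`; `r ≥ 1` makes up for the shift.
  have ht : X.c.mu * (κ / ε) ≤ X.c.t ((K : ℝ) - 1) := by
    simp only [Config.t]
    gcongr
    linarith
  have h2 : (X.c.beta - a) * (X.c.mu * (κ / ε)) ^ 2 * X.meanResidual K ≤ M := by
    have h3 : (X.c.beta - a) * (X.c.mu * (κ / ε)) ^ 2 * X.meanResidual K
        ≤ (X.c.beta - a) * X.c.t ((K : ℝ) - 1) ^ 2 * X.meanResidual K := by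
      have := X.meanResidual_nonneg K
      gcongr
    linarith
  rw [div_le_iff₀ (by positivity)] at hM
  -- As `κ ≥ 1`, the bound that is linear in `κ` may be weakened to `κ ^ 2`, avoiding a square root
  -- in the choice of `κ`.
  have h4 : M ≤ (X.c.beta - a) * X.c.mu ^ 2 * κ ^ 2 := by
    have : κ * ((X.c.beta - a) * X.c.mu ^ 2) ≤ κ ^ 2 * ((X.c.beta - a) * X.c.mu ^ 2) := by
      gcongr
      nlinarith
    linarith
  have h5 : (X.c.beta - a) * (X.c.mu * (κ / ε)) ^ 2 * X.meanResidual K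
      = (X.c.beta - a) * X.c.mu ^ 2 * κ ^ 2 * (X.meanResidual K / ε ^ 2) := by
    field_simp
  rw [h5] at h2
  have h6 : X.meanResidual K / ε ^ 2 ≤ 1 := by
    refine le_of_mul_le_mul_left ?_ (by positivity : 0 < (X.c.beta - a) * X.c.mu ^ 2 * κ ^ 2)
    linarith
  rwa [div_le_one (by positivity)] at h6

end VFOSA

/-! ### Choice of the constants and conclusion. -/

set_option maxHeartbeats 2000000 in
theorem mainTheorem12 (L Lhat ρ σ lam mu r beta R : ℝ)
    (hL : 0 < L) (hLhat : L < Lhat) (hρ : 0 ≤ ρ) (hLρ : Lhat * ρ < 1) (hσ : 0 ≤ σ)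
    (hlam_pos : 0 < lam) (hlam_ge : 2 * ρ ≤ lam)
    (hlam_lt : lam < 2 * (1 + Real.sqrt (1 - Lhat * ρ)) / Lhat)
    (hmu_pos : 0 < mu) (hmu_lt : mu < 2 / 3) (hr : 5 + 1 / mu ≤ r)
    (hbeta_pos : 0 < beta)
    (hbeta_le : beta ≤ (2 - mu) * VFOSA.betaBar lam Lhat ρ / (2 + mu)) :
    ∃ cn > (0 : ℝ), ∃ cb > (0 : ℝ), ∃ cbh > (0 : ℝ), ∃ C > (0 : ℝ),
      ∀ ε : ℝ, 0 < ε → ε ≤ 1 / 2 →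
        ∀ c : VFOSA.Config, c = VFOSA.config lam mu r beta cn cb cbh ε →
          1 ≤ c.n0 ∧ 1 ≤ c.b ∧ 1 ≤ c.bh ∧
          (∀ k : ℕ, c.tau k ∈ Set.Icc (0 : ℝ) 1) ∧
          ∃ K : ℕ,
            ∀ (p : ℕ) (Ξ Ω : Type*) [MeasurableSpace Ξ] (mΩ : MeasurableSpace Ω)
              (P : Measure Ξ) [IsProbabilityMeasure P]
              (Pr : Measure Ω) [IsProbabilityMeasure Pr]
              (bF : VFOSA.E p → Ξ → VFOSA.E p) (F : VFOSA.E p → VFOSA.E p)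
              (T : VFOSA.E p → Set (VFOSA.E p)) (x0 xs : VFOSA.E p)
              (ℱ : Filtration ℕ mΩ)
              (S0 : Ω → Fin c.n0 → Ξ) (S : ℕ → Ω → Fin c.b → Ξ) (Sh : ℕ → Ω → Fin c.bh → Ξ)
              (est0 : (Fin c.n0 → VFOSA.E p) → VFOSA.E p)
              (est : ℕ → VFOSA.E p → (Fin c.bh → VFOSA.E p) → VFOSA.E p),
              VFOSA.ExpectationSetting P bF F T L ρ σ →
              xs ∈ VFOSA.zer (VFOSA.sumOp F T) →
              x0 ∈ VFOSA.dom (VFOSA.sumOp F T) →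
              ‖x0 - xs‖ ≤ R →
              VFOSA.IsSampling P Pr ℱ S0 S Sh →
              VFOSA.IsInitialEstimator P bF F σ c.n0 x0 est0 →
              (∀ k, 1 ≤ k → VFOSA.IsBatchEstimator P bF F σ c.bh (est k)) →
              let q : ℕ → Ω → VFOSA.State p := fun k ω =>
                VFOSA.run c bF T x0 est0 est (S0 ω) (fun j => S j ω) (fun j => Sh j ω) k
              Integrable (fun ω => ‖VFOSA.residual lam F T (q K ω).x‖ ^ 2) Pr ∧
              ∫ ω, ‖VFOSA.residual lam F T (q K ω).x‖ ^ 2 ∂Pr ≤ ε ^ 2 ∧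
              Integrable (fun ω => ((q K ω).oracleCalls + (q K ω).resolventCalls : ℝ)) Pr ∧
              ∫ ω, ((q K ω).oracleCalls + (q K ω).resolventCalls : ℝ) ∂Pr ≤ C / ε ^ 3 := by
  obtain ⟨a, ha, haβ, ha'⟩ := VFOSA.exists_coercivity_parameter hbeta_pos
    (VFOSA.anchor_weight_gt hbeta_pos hmu_pos hmu_lt)
  have hβγ := VFOSA.one_add_mul_le_betaBar hbeta_pos hmu_pos hmu_lt hbeta_le
  set γ := VFOSA.betaBar lam Lhat ρ with hγ
  set c0 := VFOSA.baseConfig lam mu r beta with hc0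
  have hLam : 0 < 1 / L - 1 / Lhat := sub_pos.2 (one_div_lt_one_div_of_lt hL hLhat)
  have hE : 0 ≤ VFOSA.Experiment.errorFactor beta γ mu := by
    have h1 : 0 < γ - beta := by nlinarith [mul_pos hmu_pos hbeta_pos]
    have h2 : 0 < 2 - 3 * mu := by linarith
    unfold VFOSA.Experiment.errorFactor
    positivity
  set B := VFOSA.Experiment.errorFactor beta γ mu * (1 + 1 / (4 * mu)) with hB
  have hB0 : 0 ≤ B := by positivity
  set V0 := (c0.t (-1) * (c0.t (-1) - 1) * beta * γ⁻¹ ^ 2 + c0.weight 0) * R ^ 2 with hV0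
  set Q0 := 2 * B * (c0.t 0 * (c0.t 0 - 1) * σ ^ 2) with hQ0
  -- Target bound for the mean Lyapunov function: `V0` is the initial value, `Q0` the initial
  -- sampling error, and `1` the accumulated batch noise. It does not involve `κ`, so there is no
  -- circularity: `κ` is chosen from `M`, and then `cbh` from `κ`.
  set M := Real.exp (1 / (2 * ((1 - mu) / (2 * mu * beta) - 1 / (4 * a)) * mu ^ 2))
    * (V0 + Q0 + 1) with hM
  set κ := max 1 (M / ((beta - a) * mu ^ 2)) with hκ
  have hκ1 : 1 ≤ κ := le_max_left _ _
  -- The noise factor for the horizon `H = κ + 1 + r`, valid since `ε K ≤ κ + 1` and `ε ≤ 1`.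
  set N := 2 * mu ^ 2 * (κ + 1 + r) ^ 2 + 8 * mu ^ 2 * (1 + 1 / (4 * mu)) with hN
  have hN0 : 0 ≤ N := by positivity
  -- The factor 4 is twice what absorbing the increments requires, since taking the floor may halve
  -- the batch; the `+ 1` makes all batches nonempty for every admissible `ε`.
  set cb := 4 * B / (1 / L - 1 / Lhat) + 1 with hcb
  set cbh := 4 * (κ + 1) * B * N * σ ^ 2 + 1 with hcbh
  have hcb1 : 1 ≤ cb := by
    have : 0 ≤ 4 * B / (1 / L - 1 / Lhat) := by positivity
    linarith
  have hcbh1 : 1 ≤ cbh := by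
    have : 0 ≤ 4 * (κ + 1) * B * N * σ ^ 2 := by positivity
    linarith
  refine ⟨1, one_pos, cb, by linarith, cbh, by linarith,
    1 + (κ + 1) * (2 * cb + cbh + 1), by positivity, ?_⟩
  intro ε hε hε' c hc
  have hr5 : 0 ≤ r := by
    have : 0 < 1 / mu := by positivity
    linarith
  have hε1 : ε ≤ 1 := by linarith
  have hε2 : ε ^ 2 ≤ 1 := pow_le_one₀ hε.le hε1
  obtain ⟨hn1, hn2⟩ := VFOSA.half_le_natFloor (a := 1 / ε) (by rwa [le_div_iff₀ hε, one_mul])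
  obtain ⟨hb1, hb2⟩ := VFOSA.half_le_natFloor (a := cb / ε)
    (by rw [le_div_iff₀ hε, one_mul]; linarith)
  obtain ⟨hh1, hh2⟩ := VFOSA.half_le_natFloor (a := cbh / ε ^ 2)
    (by rw [le_div_iff₀ (by positivity), one_mul]; linarith)
  have hn0 : c.n0 = ⌊1 / ε⌋₊ := by rw [hc]; rfl
  have hb : c.b = ⌊cb / ε⌋₊ := by rw [hc]; rfl
  have hbh : c.bh = ⌊cbh / ε ^ 2⌋₊ := by rw [hc]; rfl
  have hclam : c.lam = lam := by rw [hc]; rfl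
  have hcmu : c.mu = mu := by rw [hc]; rfl
  have hcr : c.r = r := by rw [hc]; rfl
  have hcbeta : c.beta = beta := by rw [hc]; rfl
  have hctheta : c.theta = ε := by rw [hc]; rfl
  have hct : ∀ k, c.t k = c0.t k := fun k => by rw [hc]; rfl
  have hcw : ∀ k, c.weight k = c0.weight k := fun k => by rw [hc]; rfl
  refine ⟨hn0 ▸ hn1, hb ▸ hb1, hbh ▸ hh1, fun k => (VFOSA.Config.tau_spec (hcmu ▸ hmu_pos)
    (by rw [hcmu, hcr]; exact hr) (hctheta ▸ hε) (hctheta ▸ hε') k.cast_nonneg).1,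
    ⌈κ / ε⌉₊, ?_⟩
  intro p Ξ Ω _ mΩ P _ Pr _ bF F T x0 xs ℱ S0 S Sh est0 est hset hxs _ hR hsamp hinit hest q
  have hKl : κ / ε ≤ (⌈κ / ε⌉₊ : ℝ) := Nat.le_ceil _
  have hKu : (⌈κ / ε⌉₊ : ℝ) ≤ (κ + 1) / ε := by
    have h1 := (Nat.ceil_lt_add_one (by positivity : 0 ≤ κ / ε)).le
    have h2 : 1 ≤ 1 / ε := by rwa [le_div_iff₀ hε, one_mul]
    rw [add_div]
    linarith
  -- Reaching `x^K` costs one initial batch and `K - 1` later ones; positivity makes the natural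
  -- subtraction harmless.
  have hKpos : 0 < ⌈κ / ε⌉₊ := Nat.ceil_pos.2 (by positivity)
  generalize ⌈κ / ε⌉₊ = K at hKl hKu hKpos ⊢
  let X : VFOSA.Experiment p Ξ Ω :=
    { c := c, L := L, Lhat := Lhat, ρ := ρ, σ := σ, P := P, Pr := Pr, bF := bF, F := F, T := T
      x0 := x0, xs := xs, ℱ := ℱ, S0 := S0, S := S, Sh := Sh, est0 := est0, est := est
      probP := inferInstance, probPr := inferInstance, setting := hset, xs_mem := hxs
      sampling := hsamp, initial := hinit, batch := hest, L_pos := hL, L_lt := hLhat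
      Lρ_lt := hLρ, lam_pos := hclam ▸ hlam_pos, lam_ge := hclam ▸ hlam_ge
      mu_pos := hcmu ▸ hmu_pos, mu_lt := hcmu ▸ hmu_lt
      r_ge := by rw [hcmu, hcr]; exact hr
      beta_pos := hcbeta ▸ hbeta_pos
      beta_le := by rw [hcmu, hcbeta, hclam]; exact hβγ
      b_pos := hb ▸ hb1 }
  have hXmu : X.c.mu = mu := hcmu
  have hXbeta : X.c.beta = beta := hcbeta
  have hXtheta : X.c.theta = ε := hctheta
  have hv := X.meanLyapunov_le (a := a) (B := B) (H := κ + 1 + r) (K := K) (R := R)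
    (by rw [hXtheta]; exact hε) (by rw [hXtheta]; exact hε') ha (by rw [hXbeta]; exact haβ)
    (by rw [hXbeta, hXmu]; exact ha')
    (by rw [hXbeta, hXmu, show X.c.lam = lam from hclam]) (by
      change 2 * B ≤ (1 / L - 1 / Lhat) * (c.theta * (c.b : ℝ))
      rw [hctheta, hb]
      have h1 : ε * (cb / ε / 2) ≤ ε * (⌊cb / ε⌋₊ : ℝ) := by gcongr
      have h2 : ε * (cb / ε / 2) = cb / 2 := by field_simp
      have h3 : (1 / L - 1 / Lhat) * cb = 4 * B + (1 / L - 1 / Lhat) := by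
        rw [hcb, mul_add, mul_div_cancel₀ _ hLam.ne', mul_one]
      have h4 := mul_le_mul_of_nonneg_left (h2 ▸ h1) hLam.le
      linarith) (by
      rw [hXtheta, show X.c.r = r from hcr]
      have h1 : ε * K ≤ ε * ((κ + 1) / ε) := by gcongr
      have h2 : ε * ((κ + 1) / ε) = κ + 1 := by field_simp
      nlinarith) hR
  have hvM : X.meanLyapunov K ≤ M := by
    refine hv.trans ?_
    rw [hXbeta, hXmu, hXtheta, show X.c.lam = lam from hclam, show X.c.t (-1) = _ from hct _,
      show X.c.t 0 = _ from hct _, show X.c.weight 0 = _ from hcw _]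
    change Real.exp _ * (V0 + B / ε * (c0.t 0 * (c0.t 0 - 1) * (σ ^ 2 / c.n0))
      + K * (B / ε * (N * (2 * (σ ^ 2 / c.bh))))) ≤ _
    have h1 : B / ε * (c0.t 0 * (c0.t 0 - 1) * (σ ^ 2 / c.n0)) ≤ Q0 := by
      have ht : 1 + 4 * mu ≤ c0.t 0 := VFOSA.Config.t_ge (c := c0) hmu_pos hr (by norm_num)
      have hq : 0 ≤ c0.t 0 * (c0.t 0 - 1) := mul_nonneg (by linarith) (by linarith)
      have h2 : σ ^ 2 / (c.n0 : ℝ) ≤ σ ^ 2 / (1 / ε / 2) := by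
        rw [hn0]; gcongr
      calc B / ε * (c0.t 0 * (c0.t 0 - 1) * (σ ^ 2 / c.n0))
          ≤ B / ε * (c0.t 0 * (c0.t 0 - 1) * (σ ^ 2 / (1 / ε / 2))) := by gcongr
        _ = Q0 := by rw [hQ0]; field_simp
    have h2 : K * (B / ε * (N * (2 * (σ ^ 2 / c.bh)))) ≤ 1 :=
      VFOSA.accumulated_noise_le (cbh := cbh) (by linarith) hB0 hN0 hε (by linarith)
        (by linarith) (hbh ▸ hh2) hKu
    rw [hM]
    gcongr
  have hres := X.meanResidual_le hε hκ1 ha (by rw [hXbeta]; exact haβ)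
    (by rw [hXbeta, hXmu]; exact ha') (by rw [hXbeta, hXmu]; exact le_max_right _ _) hKl hvM
  have hint := X.integrable_residual K
  have hG : ∀ u, X.G u = VFOSA.residual lam F T u := fun u => by
    change VFOSA.residual c.lam F T u = _
    rw [hclam]
  -- The work is deterministic, so its expectation is that of a constant.
  have hcalls : ∀ ω, ((q K ω).oracleCalls + (q K ω).resolventCalls : ℝ)
      = c.n0 + ((K - 1 : ℕ) : ℝ) * (2 * c.b + c.bh) + K := by
    intro ω
    have h1 : (q K ω).resolventCalls = K := X.resolventCalls_eq K ω
    have h2 := X.oracleCalls_succ (K - 1) ω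
    rw [Nat.sub_add_cancel hKpos] at h2
    have h3 : (q K ω).oracleCalls = c.n0 + (K - 1) * (2 * c.b + c.bh) := h2
    rw [h1, h3]
    push_cast
    ring
  refine ⟨?_, ?_, ?_, ?_⟩
  · simp only [hG] at hint
    exact hint
  · simp only [VFOSA.Experiment.meanResidual, hG] at hres
    exact hres
  · simp only [hcalls]
    exact integrable_const _
  · simp only [hcalls, integral_const, probReal_univ, smul_eq_mul, one_mul]
    have h1 : ((K - 1 : ℕ) : ℝ) ≤ K := by exact_mod_cast Nat.sub_le K 1
    refine le_trans ?_ (VFOSA.total_calls_le (κ := κ) (cb := cb) (cbh := cbh) (K := K)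
      (n0 := c.n0) (b := c.b) (bh := c.bh) (by linarith) hε hε1 (by linarith) ?_ ?_ ?_ hKu)
    · gcongr
    · rw [hn0]; exact Nat.floor_le (by positivity)
    · rw [hb]; exact Nat.floor_le (by positivity)
    · rw [hbh]; exact Nat.floor_le (by positivity)
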